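/- Fix real numbers $a<b$, $0<\varepsilon<1$, $L>0$, $0<\mu_0<1$, $y_0$, and a sequence $\varsigma(n)\ge 1$ with $\lim_{n\to\infty}\varsigma(n)/n^{\delta}=0$ for every $\delta>0$ (for instance a constant). For $\varsigma\ge 1$ let $\mathcal P_{\varsigma}$ be the set of probability densities $p\ge 0$ on $\mathbb R$ with $\int x\,p(x)\,dx=0$, $\int x^2p(x)\,dx=1$ and $\int |x|^{2k}p(x)\,dx\le \varsigma^{k}(2k-1)!!$ for all integers $k\ge 1$. Let $\Theta_{\varepsilon,L}$ be the set of continuously differentiable $S:[a,b]\to\mathbb R$ with $\sup_{[a,b]}|S|\le 1-\varepsilon$ and $\sup_{[a,b]}|S'|\le L$. For a density $p$ and $S\in\Theta_{\varepsilon,L}$ let $\mathbf P_{p,S}$ (which depends on $n$) be the law of the process $$y_k=S(x_k)\,y_{k-1}+\xi_k,\qquad x_k=a+\frac{k(b-a)}{n},\qquad 1\le k\le n,$$ started at the constant $y_0$, where $(\xi_k)_{k\ge1}$ are i.i.d. with density $p$. Put $d=[\sqrt n]$, $h=\frac{b-a}{2d}$, $\tilde h=\frac{h}{b-a}$, $\tilde\epsilon=\frac{1}{2+\ln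 n}$, $\mathbf q=[(n\tilde h)^{\mu_0}]$, and for $1\le l\le d$ put $$z_l=a+\tfrac{l}{d}(b-a),\quad \tilde z_l=\tfrac{z_l-a}{b-a},\quad k_{1,l}=[n\tilde z_l-n\tilde h]+1,\quad k_{2,l}=\min([n\tilde z_l+n\tilde h],n),\quad \iota_l=k_{1,l}+\mathbf q,$$ where $[\cdot]$ is the integer part. Let $Q_{l,j}=1$ if $|x_j-z_l|\le h$ and $Q_{l,j}=0$ otherwise, and $$A_{k,m}=\sum_{j=k+1}^{m}Q_{l,j}\,y_{j-1}^2,\quad \hat S_{\iota_l}=\frac{1}{A_{0,\iota_l}}\sum_{j=1}^{\iota_l}Q_{l,j}\,y_{j-1}y_j,\quad \tilde S_{\iota_l}=\min\bigl(\max(\hat S_{\iota_l},-1+\tilde\epsilon),1-\tilde\epsilon\bigr),$$ $$H_l=\frac{1-\tilde\epsilon}{1-\tilde S_{\iota_l}^2}\,(k_{2,l}-\iota_l-1),\qquad \Gamma=\bigcap_{l=1}^{d}\bigl\{A_{\iota_l,k_{2,l}-1}\ge H_l\bigr\}$$ (in $A_{\iota_l,k_{2,l}-1}$ the weights are the $Q_{l,j}$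 with the same $l$). Then for every choice of densities $p_n\in\mathcal P_{\varsigma(n)}$, $n\ge1$ (in particular for a fixed density $p$ lying in all these classes), and every $\mathbf b>0$, $$\lim_{n\to\infty}n^{\mathbf b}\sup_{S\in\Theta_{\varepsilon,L}}\mathbf P_{p_n,S}(\Gamma^c)=0 .$$ -/

import Mathlib

open Set Filter Topology MeasureTheory
open scoped ENNReal Nat

noncomputable section

namespace SeqAR

/-- The class of noise densities with parameter `ς`: centred, with unit variance, and with
`∫ |x|^(2k) p(x) dx ≤ ς^k (2k-1)!!` for all `k ≥ 1`.  Integrability of `p` and of `x² p`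
is forced by the two integrals being equal to `1` (hence `x p` is integrable as well). -/
def densityClass (ς : ℝ) : Set (ℝ → ℝ) :=
  {p | (∀ x, 0 ≤ p x) ∧ ∫ x, p x = 1 ∧ ∫ x, x * p x = 0 ∧ ∫ x, x ^ 2 * p x = 1 ∧
    ∀ k : ℕ, 1 ≤ k → Integrable (fun x => |x| ^ (2 * k) * p x) ∧
      (∫ x, |x| ^ (2 * k) * p x) / (ς ^ k * ((2 * k - 1)‼ : ℕ)) ≤ 1}

/-- The law on `ℝ` with Lebesgue density `p`. -/
def noiseLaw (p : ℝ → ℝ) : Measure ℝ :=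
  volume.withDensity fun x => ENNReal.ofReal (p x)

instance isProbabilityMeasure_noiseLaw {ς : ℝ} (p : densityClass ς) :
    IsProbabilityMeasure (noiseLaw p.1) := by
  obtain ⟨p, h0, h1, -⟩ := p
  have hi : Integrable p := by
    by_contra h
    rw [integral_undef h] at h1
    exact zero_ne_one h1
  refine ⟨?_⟩
  simp only [noiseLaw, withDensity_apply _ MeasurableSet.univ, Measure.restrict_univ]
  rw [← ofReal_integral_eq_lintegral_ofReal hi (Eventually.of_forall h0), h1,
    ENNReal.ofReal_one]

/-- The stability set `Θ_{ε,L}`: continuously differentiable functions on `[a,b]` with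
`sup |S| ≤ 1 - ε` and `sup |S'| ≤ L`.  Values outside `[a,b]` are never used by the model. -/
def stabilitySet (a b ε L : ℝ) : Set (ℝ → ℝ) :=
  {S | ContDiffOn ℝ 1 S (Icc a b) ∧ (∀ x ∈ Icc a b, |S x| ≤ 1 - ε) ∧
    ∀ x ∈ Icc a b, |derivWithin S (Icc a b) x| ≤ L}

/-- The observation points `x_k = a + k (b - a) / n`. -/
def xPt (a b : ℝ) (n k : ℕ) : ℝ := a + k * (b - a) / n

/-- The autoregression `y_k = S(x_k) y_{k-1} + ξ_k`, started at the constant `y₀`;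
only the times `k ≤ n` are observed. -/
def path (a b y₀ : ℝ) (n : ℕ) (S : ℝ → ℝ) (ξ : ℕ → ℝ) : ℕ → ℝ
  | 0 => y₀
  | k + 1 => S (xPt a b n (k + 1)) * path a b y₀ n S ξ k + ξ (k + 1)

theorem measurable_path (a b y₀ : ℝ) (n : ℕ) (S : ℝ → ℝ) :
    Measurable (path a b y₀ n S) := by
  refine measurable_pi_iff.2 fun k => ?_
  induction k with
  | zero => exact measurable_const
  | succ k ih => exact (ih.const_mul _).add (measurable_pi_apply (k + 1))

/-- The law `P_{p,S}` of the process `y` when the noise is i.i.d. with density `p`. -/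
def obsLaw (a b y₀ : ℝ) (n : ℕ) {ς : ℝ} (p : densityClass ς) (S : ℝ → ℝ) :
    Measure (ℕ → ℝ) :=
  (Measure.infinitePi fun _ : ℕ => noiseLaw p.1).map (path a b y₀ n S)

instance isProbabilityMeasure_obsLaw (a b y₀ : ℝ) (n : ℕ) {ς : ℝ} (p : densityClass ς)
    (S : ℝ → ℝ) : IsProbabilityMeasure (obsLaw a b y₀ n p S) :=
  Measure.isProbabilityMeasure_map (measurable_path a b y₀ n S).aemeasurable

/-- The number of estimation points, `d = [√n]`. -/
def dim (n : ℕ) : ℕ := ⌊Real.sqrt n⌋₊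

/-- The estimation points `z_l = a + (l/d)(b - a)`. -/
def zPt (a b : ℝ) (n l : ℕ) : ℝ := a + (l : ℝ) / dim n * (b - a)

/-- The bandwidth `h = (b - a) / (2 d)`. -/
def bandwidth (a b : ℝ) (n : ℕ) : ℝ := (b - a) / (2 * dim n)

/-- The normalised point `(z_l - a) / (b - a)`. -/
def zNorm (a b : ℝ) (n l : ℕ) : ℝ := (zPt a b n l - a) / (b - a)

/-- The normalised bandwidth `h / (b - a)`. -/
def hNorm (a b : ℝ) (n : ℕ) : ℝ := bandwidth a b n / (b - a)

/-- The indicator kernel `Q = 1_{[-1,1]}`. -/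
def kernel (u : ℝ) : ℝ := indicator (Icc (-1) 1) (fun _ => 1) u

/-- The weights `Q_{l,j} = Q((x_j - z_l) / h)`. -/
def weight (a b : ℝ) (n l j : ℕ) : ℝ :=
  kernel ((xPt a b n j - zPt a b n l) / bandwidth a b n)

/-- `k_{1,l} = [n z̃_l - n h̃] + 1`; the bracket has a nonnegative argument for `l ≥ 1`. -/
def kOne (a b : ℝ) (n l : ℕ) : ℕ := ⌊n * zNorm a b n l - n * hNorm a b n⌋₊ + 1

/-- `k_{2,l} = [n z̃_l + n h̃] ∧ n`. -/
def kTwo (a b : ℝ) (n l : ℕ) : ℕ := min ⌊n * zNorm a b n l + n * hNorm a b n⌋₊ n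

/-- `q = [(n h̃)^{μ₀}]`. -/
def qLen (a b μ₀ : ℝ) (n : ℕ) : ℕ := ⌊(n * hNorm a b n) ^ μ₀⌋₊

/-- `ι_l = k_{1,l} + q`. -/
def iotaIdx (a b μ₀ : ℝ) (n l : ℕ) : ℕ := kOne a b n l + qLen a b μ₀ n

/-- `A_{k,m} = ∑_{j=k+1}^m Q_{l,j} y_{j-1}²`. -/
def energy (a b : ℝ) (n l k m : ℕ) (y : ℕ → ℝ) : ℝ :=
  ∑ j ∈ Finset.Ioc k m, weight a b n l j * y (j - 1) ^ 2

/-- The preliminary kernel estimator of `S(z_l)` from the first `ι_l` observations. -/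
def prelimEst (a b μ₀ : ℝ) (n l : ℕ) (y : ℕ → ℝ) : ℝ :=
  (∑ j ∈ Finset.Ioc 0 (iotaIdx a b μ₀ n l), weight a b n l j * y (j - 1) * y j) /
    energy a b n l 0 (iotaIdx a b μ₀ n l) y

/-- `ε̃ = 1 / (2 + ln n)`. -/
def epsTilde (n : ℕ) : ℝ := 1 / (2 + Real.log n)

/-- The projection of the preliminary estimator onto `[-1 + ε̃, 1 - ε̃]`. -/
def projEst (a b μ₀ : ℝ) (n l : ℕ) (y : ℕ → ℝ) : ℝ :=
  min (max (prelimEst a b μ₀ n l y) (-1 + epsTilde n)) (1 - epsTilde n)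

/-- The threshold `H_l = (1 - ε̃) (k_{2,l} - ι_l - 1) / γ̃_l`, where `γ̃_l` is one minus the
square of the projected estimator. -/
def threshold (a b μ₀ : ℝ) (n l : ℕ) (y : ℕ → ℝ) : ℝ :=
  (1 - epsTilde n) / (1 - projEst a b μ₀ n l y ^ 2) *
    ((kTwo a b n l : ℝ) - iotaIdx a b μ₀ n l - 1)

/-- The event `Γ_l = {A_{ι_l, k_{2,l} - 1} ≥ H_l}`. -/
def gammaEvent (a b μ₀ : ℝ) (n l : ℕ) : Set (ℕ → ℝ) :=
  {y | threshold a b μ₀ n l y ≤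
    energy a b n l (iotaIdx a b μ₀ n l) (kTwo a b n l - 1) y}

/-- The event `Γ = ⋂_{1 ≤ l ≤ d} Γ_l`. -/
def gammaAll (a b μ₀ : ℝ) (n : ℕ) : Set (ℕ → ℝ) :=
  ⋂ l ∈ Finset.Icc 1 (dim n), gammaEvent a b μ₀ n l

end SeqAR

end

namespace SeqAR

open ProbabilityTheory

/-! Squaring the recursion and telescoping over a window `Ioc s t` expresses the energy through its
length, a cross sum of `S(x_j) y_{j-1} ξ_j`, a sum of `ξ_j² - 1` and boundary terms
(`sum_sq_pred_identity`). If the fluctuations are at most `τ` times the length and `S` is nearly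
constant there, the energy is at least about the length divided by `1 - S(z_l)²`
(`le_energy_window`). The same bound on the first `q` steps keeps the estimator's denominator away
from zero, so the projected estimator is close to `S(z_l)`. The factor `1 - ε̃` in the threshold
absorbs all errors once `τ = ε̃ε/16` and `8Lh ≤ ε̃ε` (`threshold_le_energy`). This part is
deterministic.

Seven fluctuation events can fail per window. Each is controlled by Markov's inequality at an
arbitrary even order, using a moment bound for sums of martingale differences
(`exists_integral_sum_pow_le`) and uniform moments of the path. A window thus fails with probability
at most `C (ς²/(τ²q))^(k+1)`, where `C` does not depend on `S`, `p`, `n` or `l`. The base is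
eventually at most `n^(-μ₀/4)`, because `q` grows at least like `n^(μ₀/2)` while `ς` and `1/ε̃` grow
slower than any power. A large `k` beats both `n^β` and the union over the `d` windows. -/

/-! ### Second-order expansion of powers -/

theorem abs_pow_mul_abs_pow_le (n i j : ℕ) (h : n = i + j) (a x : ℝ) :
    |a| ^ i * |x| ^ (j + 2) ≤ |a| ^ n * x ^ 2 + |x| ^ (n + 2) := by
  subst h
  rw [← sq_abs x]
  have ha := abs_nonneg a
  have hx := abs_nonneg x
  rcases le_total |x| |a| with hc | hc
  · have h1 : |a| ^ i * |x| ^ (j + 2) ≤ |a| ^ (i + j) * |x| ^ 2 := by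
      rw [pow_add, pow_add, ← mul_assoc]
      gcongr
    have : 0 ≤ |x| ^ (i + j + 2) := by positivity
    linarith
  · have h1 : |a| ^ i * |x| ^ (j + 2) ≤ |x| ^ (i + j + 2) := by
      rw [add_assoc i j 2, pow_add |x| i]
      gcongr
    have : 0 ≤ |a| ^ (i + j) * |x| ^ 2 := by positivity
    linarith

theorem exists_abs_add_pow_sub_le (n : ℕ) : ∃ C : ℝ, 0 ≤ C ∧ ∀ a x : ℝ,
    |(a + x) ^ (n + 2) - a ^ (n + 2) - (n + 2) * a ^ (n + 1) * x| ≤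
      C * (|a| ^ n * x ^ 2 + |x| ^ (n + 2)) := by
  induction n with
  | zero =>
    refine ⟨1, zero_le_one, fun a x => ?_⟩
    have : (a + x) ^ (0 + 2) - a ^ (0 + 2) - ((0 : ℕ) + 2) * a ^ (0 + 1) * x = x ^ 2 := by
      push_cast; ring
    rw [this, abs_of_nonneg (sq_nonneg x)]
    simp [sq_nonneg]
  | succ n ih =>
    obtain ⟨C, hC, h⟩ := ih
    refine ⟨(n + 2) + 4 * C, by positivity, fun a x => ?_⟩
    set R := (a + x) ^ (n + 2) - a ^ (n + 2) - (n + 2) * a ^ (n + 1) * x with hR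
    -- Multiplying the previous expansion by `a + x` leaves one new second-order term, so the
    -- remainder obeys a recursion in the exponent.
    have e : (a + x) ^ (n + 1 + 2) - a ^ (n + 1 + 2) - ((n + 1 : ℕ) + 2) * a ^ (n + 1 + 1) * x =
        (n + 2) * (a ^ (n + 1) * x ^ 2) + (a + x) * R := by
      rw [hR]; push_cast; ring
    have h0 := abs_pow_mul_abs_pow_le (n + 1) (n + 1) 0 rfl a x
    have h1 := abs_pow_mul_abs_pow_le (n + 1) 1 n (by ring) a x
    have h2 := abs_pow_mul_abs_pow_le (n + 1) n 1 rfl a x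
    have h3 := abs_pow_mul_abs_pow_le (n + 1) 0 (n + 1) (by ring) a x
    set T := |a| ^ (n + 1) * x ^ 2 + |x| ^ (n + 1 + 2) with hT
    have hR' : |(a + x) * R| ≤ 4 * C * T := by
      rw [abs_mul]
      calc |a + x| * |R| ≤ (|a| + |x|) * (C * (|a| ^ n * |x| ^ 2 + |x| ^ (n + 2))) := by
            rw [sq_abs]
            exact mul_le_mul (abs_add_le a x) (h a x) (abs_nonneg _) (by positivity)
        _ = C * (|a| ^ (n + 1) * |x| ^ (0 + 2) + |a| ^ 1 * |x| ^ (n + 2) +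
              |a| ^ n * |x| ^ (1 + 2) + |a| ^ 0 * |x| ^ (n + 1 + 2)) := by ring
        _ ≤ C * (T + T + T + T) := by gcongr
        _ = 4 * C * T := by ring
    rw [e]
    calc |(n + 2) * (a ^ (n + 1) * x ^ 2) + (a + x) * R|
        ≤ |(n + 2) * (a ^ (n + 1) * x ^ 2)| + |(a + x) * R| := abs_add_le _ _
      _ ≤ (n + 2) * T + 4 * C * T := by
          refine add_le_add ?_ hR'
          rw [abs_mul, abs_mul, abs_pow, abs_pow, abs_of_nonneg (by positivity : (0:ℝ) ≤ n + 2)]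
          gcongr
      _ = _ := by ring

/-- A second-order bound for even powers with a free balancing parameter `r`. -/
theorem exists_even_pow_add_le (k : ℕ) : ∃ C : ℝ, 0 ≤ C ∧ ∀ r : ℝ, 1 ≤ r → ∀ a x : ℝ,
    (a + x) ^ (2 * (k + 1)) ≤ (1 + C / r) * a ^ (2 * (k + 1)) +
      2 * (k + 1) * (a ^ (2 * k + 1) * x) + C * r ^ k * x ^ (2 * (k + 1)) := by
  obtain ⟨C, hC, h⟩ := exists_abs_add_pow_sub_le (2 * k)
  refine ⟨2 * C, by positivity, fun r hr a x => ?_⟩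
  have h1 := (le_abs_self _).trans (h a x)
  have hx0 : (0 : ℝ) ≤ x ^ (2 * (k + 1)) := by rw [pow_mul]; positivity
  have ha0 : (0 : ℝ) ≤ a ^ (2 * (k + 1)) := by rw [pow_mul]; positivity
  have hr0 : 0 < r := by linarith
  have h2 : |a| ^ (2 * k) * x ^ 2 ≤ a ^ (2 * (k + 1)) / r + r ^ k * x ^ (2 * (k + 1)) := by
    have e1 : |a| ^ (2 * k) = (a ^ 2) ^ k := by rw [pow_mul, sq_abs]
    have e2 : a ^ (2 * (k + 1)) = (a ^ 2) ^ k * a ^ 2 := by rw [pow_mul, pow_succ]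
    have e3 : x ^ (2 * (k + 1)) = (x ^ 2) ^ k * x ^ 2 := by rw [pow_mul, pow_succ]
    -- Either `x²` is at most `a²/r`, which gives the small multiple of the power of `a`, or `a² ≤ r
    -- x²`, which costs the factor `r^k`.
    rcases le_total (r * x ^ 2) (a ^ 2) with hc | hc
    · have : |a| ^ (2 * k) * x ^ 2 ≤ a ^ (2 * (k + 1)) / r := by
        rw [e1, e2, mul_div_assoc]
        gcongr
        rw [le_div_iff₀ hr0]; linarith
      have : 0 ≤ r ^ k * x ^ (2 * (k + 1)) := by positivity
      linarith
    · have : |a| ^ (2 * k) * x ^ 2 ≤ r ^ k * x ^ (2 * (k + 1)) := by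
        rw [e1, e3, ← mul_assoc, ← mul_pow]
        gcongr
      have : 0 ≤ a ^ (2 * (k + 1)) / r := by positivity
      linarith
  have h3 : |x| ^ (2 * k + 2) ≤ r ^ k * x ^ (2 * (k + 1)) := by
    rw [show 2 * k + 2 = 2 * (k + 1) by ring, pow_mul, sq_abs, ← pow_mul]
    exact le_mul_of_one_le_left hx0 (one_le_pow₀ hr)
  have h4 : C * (|a| ^ (2 * k) * x ^ 2 + |x| ^ (2 * k + 2)) ≤
      C * (a ^ (2 * (k + 1)) / r + r ^ k * x ^ (2 * (k + 1)) + r ^ k * x ^ (2 * (k + 1))) := by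
    gcongr
  have h5 : 0 ≤ C * (a ^ (2 * (k + 1)) / r) := by positivity
  have e4 : 2 * k + 2 = 2 * (k + 1) := by ring
  rw [e4] at h1 h4
  have e5 : (1 + 2 * C / r) * a ^ (2 * (k + 1)) =
      a ^ (2 * (k + 1)) + 2 * (C * (a ^ (2 * (k + 1)) / r)) := by ring
  rw [e5]
  push_cast at h1
  linear_combination h1 + h4 + h5

/-! ### Moments of martingale-type sums -/

variable {Ω : Type*} {mΩ : MeasurableSpace Ω} {μ : Measure Ω}

/-- All absolute moments of `X` are finite. -/
def AllMoments (X : Ω → ℝ) (μ : Measure Ω) : Prop := ∀ p : ℕ, MemLp X p μ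

namespace AllMoments

variable {X Y : Ω → ℝ}

theorem aestronglyMeasurable (hX : AllMoments X μ) : AEStronglyMeasurable X μ :=
  (hX 0).aestronglyMeasurable

theorem add (hX : AllMoments X μ) (hY : AllMoments Y μ) :
    AllMoments (fun ω => X ω + Y ω) μ := fun p => (hX p).add (hY p)

/-- Hölder with both exponents equal to `2p`. Closure under products is the reason for asking for
all exponents at once. -/
theorem mul (hX : AllMoments X μ) (hY : AllMoments Y μ) :
    AllMoments (fun ω => X ω * Y ω) μ := fun p => by
  have : ENNReal.HolderTriple ((2 * p : ℕ) : ℝ≥0∞) ((2 * p : ℕ) : ℝ≥0∞) (p : ℝ≥0∞) := by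
    constructor
    push_cast
    rw [ENNReal.mul_inv (by simp) (by simp), ← add_mul, ENNReal.inv_two_add_inv_two, one_mul]
  exact (hY (2 * p)).mul' (hX (2 * p))

theorem const [IsFiniteMeasure μ] (c : ℝ) : AllMoments (fun _ : Ω => c) μ :=
  fun _ => memLp_const c

theorem pow [IsFiniteMeasure μ] (hX : AllMoments X μ) (k : ℕ) :
    AllMoments (fun ω => X ω ^ k) μ := by
  induction k with
  | zero => simpa using const 1
  | succ k ih => simpa only [pow_succ] using ih.mul hX

theorem integrable (hX : AllMoments X μ) : Integrable X μ :=
  memLp_one_iff_integrable.1 (by simpa using hX 1)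

theorem sum [IsFiniteMeasure μ] {ι : Type*} {s : Finset ι} {X : ι → Ω → ℝ}
    (hX : ∀ i, AllMoments (X i) μ) : AllMoments (fun ω => ∑ i ∈ s, X i ω) μ := by
  classical
  induction s using Finset.induction_on with
  | empty => simpa using const 0
  | insert i s hi ih => simpa only [Finset.sum_insert hi] using (hX i).add ih

end AllMoments

/-- Even moments of a sum of increments satisfying the martingale orthogonality relation. -/
theorem exists_integral_sum_pow_le (k : ℕ) : ∃ C : ℝ, 0 ≤ C ∧
    ∀ {Ω : Type} [MeasurableSpace Ω] (μ : Measure Ω) [IsProbabilityMeasure μ]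
      (X : ℕ → Ω → ℝ) (B : ℝ) (m N : ℕ), 1 ≤ m → N ≤ m → 0 ≤ B → (∀ j, AllMoments (X j) μ) →
      (∀ j, ∫ ω, (∑ i ∈ Finset.range j, X i ω) ^ (2 * k + 1) * X j ω ∂μ = 0) →
      (∀ j < N, ∫ ω, X j ω ^ (2 * (k + 1)) ∂μ ≤ B) →
      ∫ ω, (∑ i ∈ Finset.range N, X i ω) ^ (2 * (k + 1)) ∂μ ≤ C * m ^ (k + 1) * B := by
  obtain ⟨C, hC, h⟩ := exists_even_pow_add_le k
  refine ⟨C * Real.exp C, by positivity, ?_⟩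
  intro Ω _ μ _ X B m N hm hNm hB0 hX horth hB
  have hm1 : (1 : ℝ) ≤ m := by exact_mod_cast hm
  have hm0 : (0 : ℝ) < m := by linarith
  have hone : 1 ≤ 1 + C / m := by
    have : 0 ≤ C / m := by positivity
    linarith
  have hM : ∀ j, AllMoments (fun ω => ∑ i ∈ Finset.range j, X i ω) μ := fun j =>
    AllMoments.sum hX
  -- A discrete Gronwall argument. With balancing parameter `r = m`, a step multiplies the moment by
  -- `1 + C/m` and adds `C m^k B`; orthogonality removes the linear term. At most `m` steps cost a
  -- factor `exp C`.
  have key : ∀ j ≤ N, ∫ ω, (∑ i ∈ Finset.range j, X i ω) ^ (2 * (k + 1)) ∂μ ≤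
      (1 + C / m) ^ j * (j * (C * m ^ k * B)) := by
    intro j
    induction j with
    | zero => simp
    | succ j ih =>
      intro hj
      have i1 : Integrable (fun ω => (1 + C / m) *
          (∑ i ∈ Finset.range j, X i ω) ^ (2 * (k + 1))) μ :=
        ((hM j).pow _).integrable.const_mul _
      have i2 : Integrable (fun ω => 2 * ((k : ℝ) + 1) *
          ((∑ i ∈ Finset.range j, X i ω) ^ (2 * k + 1) * X j ω)) μ :=
        (((hM j).pow _).mul (hX j)).integrable.const_mul _
      have i3 : Integrable (fun ω => C * m ^ k * X j ω ^ (2 * (k + 1))) μ :=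
        ((hX j).pow _).integrable.const_mul _
      have i12 : Integrable (fun ω => (1 + C / m) *
          (∑ i ∈ Finset.range j, X i ω) ^ (2 * (k + 1)) + 2 * ((k : ℝ) + 1) *
          ((∑ i ∈ Finset.range j, X i ω) ^ (2 * k + 1) * X j ω)) μ := i1.add i2
      have hstep := integral_mono ((hM (j + 1)).pow (2 * (k + 1))).integrable (i12.add i3)
        (fun ω => by
          simp only [Finset.sum_range_succ, Pi.add_apply]
          exact h m hm1 _ _)
      simp only [Pi.add_apply] at hstep
      rw [integral_add i12 i3, integral_add i1 i2,
        integral_const_mul, integral_const_mul, integral_const_mul, horth j, mul_zero,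
        add_zero] at hstep
      have h1 : (1 + C / m) * ∫ ω, (∑ i ∈ Finset.range j, X i ω) ^ (2 * (k + 1)) ∂μ ≤
          (1 + C / m) * ((1 + C / m) ^ j * (j * (C * m ^ k * B))) :=
        mul_le_mul_of_nonneg_left (ih (by omega)) (by linarith)
      have h2 : C * m ^ k * ∫ ω, X j ω ^ (2 * (k + 1)) ∂μ ≤ C * m ^ k * B :=
        mul_le_mul_of_nonneg_left (hB j hj) (by positivity)
      have h3 : C * m ^ k * B ≤ (1 + C / m) ^ (j + 1) * (C * m ^ k * B) :=
        le_mul_of_one_le_left (by positivity) (one_le_pow₀ hone)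
      have h5 : (1 + C / m) ^ (j + 1) * (((j + 1 : ℕ) : ℝ) * (C * m ^ k * B)) =
          (1 + C / m) ^ (j + 1) * (j * (C * m ^ k * B)) +
            (1 + C / m) ^ (j + 1) * (C * m ^ k * B) := by push_cast; ring
      have h4 : (1 + C / m) * ((1 + C / m) ^ j * (j * (C * m ^ k * B))) =
        (1 + C / m) ^ (j + 1) * (j * (C * m ^ k * B)) := by ring
      linarith
  refine (key N le_rfl).trans ?_
  have h1 : (1 + C / m) ^ N ≤ Real.exp C := by
    calc (1 + C / m) ^ N ≤ (1 + C / m) ^ m := pow_le_pow_right₀ hone hNm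
      _ ≤ (Real.exp (C / m)) ^ m := by
          gcongr
          rw [add_comm]
          exact Real.add_one_le_exp _
      _ = Real.exp C := by
          rw [← Real.exp_nat_mul]
          congr 1
          field_simp
  have h2 : (N : ℝ) ≤ m := by exact_mod_cast hNm
  calc (1 + C / m) ^ N * (N * (C * m ^ k * B)) ≤ Real.exp C * (m * (C * m ^ k * B)) := by gcongr
    _ = _ := by ring

/-- Markov's inequality for even powers. -/
theorem measure_lt_abs_le [IsProbabilityMeasure μ] {X : Ω → ℝ} (hX : AllMoments X μ) (k : ℕ)
    {t D : ℝ} (ht : 0 < t) (hD : ∫ ω, X ω ^ (2 * k) ∂μ ≤ D) :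
    μ {ω | t < |X ω|} ≤ ENNReal.ofReal (D / t ^ (2 * k)) := by
  have h1 := mul_meas_ge_le_integral_of_nonneg (μ := μ) (f := fun ω => X ω ^ (2 * k))
    (Eventually.of_forall fun ω => by simp only [Pi.zero_apply, pow_mul]; positivity)
    (hX.pow _).integrable (t ^ (2 * k))
  have h2 : μ {ω | t < |X ω|} ≤ μ {ω | t ^ (2 * k) ≤ X ω ^ (2 * k)} := by
    refine measure_mono fun ω hω => ?_
    simp only [mem_ofPred_eq] at hω ⊢
    calc t ^ (2 * k) ≤ |X ω| ^ (2 * k) := pow_le_pow_left₀ ht.le hω.le _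
      _ = X ω ^ (2 * k) := by rw [pow_mul, pow_mul, sq_abs]
  refine h2.trans ?_
  rw [← ofReal_measureReal]
  refine ENNReal.ofReal_le_ofReal ?_
  rw [le_div_iff₀ (by positivity), mul_comm]
  exact h1.trans hD

/-! ### Predictable sums on the product space -/

/-- The filtration generated by the coordinates of a real sequence. -/
noncomputable def coordFiltration : Filtration ℕ (inferInstance : MeasurableSpace (ℕ → ℝ)) :=
  Filtration.natural (fun i (ω : ℕ → ℝ) => ω i) fun i => (measurable_pi_apply i).stronglyMeasurable

theorem measurable_coord_coordFiltration {i j : ℕ} (hij : i ≤ j) :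
    Measurable[coordFiltration j] (fun ω : ℕ → ℝ => ω i) :=
  ((Filtration.stronglyAdapted_natural
    (fun i => (measurable_pi_apply (X := fun _ : ℕ => ℝ) i).stronglyMeasurable) i).measurable).mono
    (coordFiltration.mono hij) le_rfl

theorem measurable_path_coordFiltration (a b y₀ : ℝ) (n : ℕ) (S : ℝ → ℝ) (k : ℕ) :
    Measurable[coordFiltration k] (fun ω => path a b y₀ n S ω k) := by
  induction k with
  | zero => exact measurable_const
  | succ k ih =>
    have h1 : Measurable[coordFiltration (k + 1)] (fun ω => path a b y₀ n S ω k) :=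
      ih.mono (coordFiltration.mono k.le_succ) le_rfl
    exact (h1.const_mul _).add (measurable_coord_coordFiltration le_rfl)

theorem indepFun_coordFiltration (ν : Measure ℝ) [IsProbabilityMeasure ν] {F : (ℕ → ℝ) → ℝ}
    {j : ℕ} (hF : Measurable[coordFiltration j] F) {g : ℝ → ℝ} (hg : Measurable g) :
    IndepFun F (fun ω => g (ω (j + 1))) (Measure.infinitePi fun _ : ℕ => ν) := by
  have h := iIndepFun_infinitePi (P := fun _ : ℕ => ν) (X := fun _ x => x)
    (fun _ => measurable_id)
  have h2 := h.indep_comap_natural_of_lt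
    (fun i => (measurable_pi_apply (X := fun _ : ℕ => ℝ) i).stronglyMeasurable) (Nat.lt_succ_self j)
  rw [IndepFun_iff_Indep]
  refine indep_of_indep_of_le_left (indep_of_indep_of_le_right h2.symm ?_) hF.comap_le
  exact (hg.comp (comap_measurable _)).comap_le

theorem integral_coord (ν : Measure ℝ) [IsProbabilityMeasure ν] {g : ℝ → ℝ} (hg : Measurable g)
    (j : ℕ) : ∫ ω, g (ω j) ∂(Measure.infinitePi fun _ : ℕ => ν) = ∫ x, g x ∂ν := by
  have h := measurePreserving_eval_infinitePi (fun _ : ℕ => ν) j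
  conv_rhs => rw [← h.map_eq]
  exact (integral_map h.aemeasurable hg.aestronglyMeasurable).symm

theorem allMoments_coord (ν : Measure ℝ) [IsProbabilityMeasure ν] {g : ℝ → ℝ}
    (hg : AllMoments g ν) (j : ℕ) :
    AllMoments (fun ω => g (ω j)) (Measure.infinitePi fun _ : ℕ => ν) := fun p =>
  (hg p).comp_measurePreserving (measurePreserving_eval_infinitePi (fun _ : ℕ => ν) j)

/-- Even moments of a sum of predictable multiples of i.i.d. centred variables. -/
theorem exists_integral_predictable_sum_pow_le (k : ℕ) : ∃ C : ℝ, 0 ≤ C ∧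
    ∀ (ν : Measure ℝ) [IsProbabilityMeasure ν] (u : ℕ → (ℕ → ℝ) → ℝ) (g : ℝ → ℝ) (U G : ℝ)
      (s m N : ℕ), (∀ j, Measurable[coordFiltration j] (u j)) →
      (∀ j, AllMoments (u j) (Measure.infinitePi fun _ : ℕ => ν)) →
      Measurable g → AllMoments g ν → ∫ x, g x ∂ν = 0 → 0 ≤ U → 0 ≤ G → 1 ≤ m → N ≤ m →
      (∀ j < N, ∫ ω, u (s + j) ω ^ (2 * (k + 1)) ∂(Measure.infinitePi fun _ : ℕ => ν) ≤ U) →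
      ∫ x, g x ^ (2 * (k + 1)) ∂ν ≤ G →
      ∫ ω, (∑ i ∈ Finset.range N, u (s + i) ω * g (ω (s + i + 1))) ^ (2 * (k + 1))
        ∂(Measure.infinitePi fun _ : ℕ => ν) ≤ C * m ^ (k + 1) * (U * G) := by
  obtain ⟨C, hC, h⟩ := exists_integral_sum_pow_le k
  refine ⟨C, hC, ?_⟩
  intro ν _ u g U G s m N hu huM hg hgM hg0 hU hG hm hNm huU hgG
  have hsum : ∀ j, Measurable[coordFiltration (s + j)]
      (fun ω => ∑ i ∈ Finset.range j, u (s + i) ω * g (ω (s + i + 1))) := fun j =>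
    Finset.measurable_sum _ fun i hi => by
      have hij := Finset.mem_range.1 hi
      exact ((hu (s + i)).mono (coordFiltration.mono (by omega)) le_rfl).mul
        (hg.comp (measurable_coord_coordFiltration (by omega)))
  have hle : ∀ j, coordFiltration j ≤ (inferInstance : MeasurableSpace (ℕ → ℝ)) :=
    coordFiltration.le
  refine h _ (fun i ω => u (s + i) ω * g (ω (s + i + 1))) (U * G) m N hm hNm (by positivity)
    (fun j => (huM _).mul (allMoments_coord ν hgM _)) (fun j => ?_) (fun j hj => ?_)
  -- Orthogonality: everything except the last factor is known at time `s + j`, and that factor is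
  -- centred and independent of it.
  · have hF : Measurable[coordFiltration (s + j)] (fun ω =>
        (∑ i ∈ Finset.range j, u (s + i) ω * g (ω (s + i + 1))) ^ (2 * k + 1) * u (s + j) ω) :=
      ((hsum j).pow_const _).mul (hu _)
    have h1 := (indepFun_coordFiltration ν hF hg).integral_fun_mul_eq_mul_integral
      (hF.mono (hle _) le_rfl).aestronglyMeasurable
      (hg.comp (measurable_pi_apply _)).aestronglyMeasurable
    simp only [← mul_assoc]
    rw [h1, integral_coord ν hg, hg0, mul_zero]
  · have hF : Measurable[coordFiltration (s + j)] (fun ω => u (s + j) ω ^ (2 * (k + 1))) :=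
      (hu _).pow_const _
    have hg' : Measurable (fun x => g x ^ (2 * (k + 1))) := hg.pow_const _
    have h1 := (indepFun_coordFiltration ν hF hg').integral_fun_mul_eq_mul_integral
      (hF.mono (hle _) le_rfl).aestronglyMeasurable
      (hg'.comp (measurable_pi_apply _)).aestronglyMeasurable
    simp only [mul_pow]
    rw [h1, integral_coord ν hg']
    exact mul_le_mul (huU j hj) hgG
      (integral_nonneg fun x => by simp only [Pi.zero_apply, pow_mul]; positivity) hU

/-! ### Moments of the noise -/

section Noise

variable {ς : ℝ} (p : densityClass ς)

theorem integrable_density : Integrable p.1 := by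
  by_contra h
  have h1 := p.2.2.1
  rw [integral_undef h] at h1
  exact zero_ne_one h1

theorem integral_noiseLaw (f : ℝ → ℝ) : ∫ x, f x ∂(noiseLaw p.1) = ∫ x, f x * p.1 x := by
  rw [noiseLaw, integral_withDensity_eq_integral_toReal_smul₀
    (integrable_density p).aemeasurable.ennreal_ofReal (by simp)]
  refine integral_congr_ae (Eventually.of_forall fun x => ?_)
  simp [ENNReal.toReal_ofReal (p.2.1 x), mul_comm]

theorem integrable_noiseLaw_iff (f : ℝ → ℝ) :
    Integrable f (noiseLaw p.1) ↔ Integrable (fun x => f x * p.1 x) := by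
  rw [noiseLaw, integrable_withDensity_iff_integrable_smul₀'
    (integrable_density p).aemeasurable.ennreal_ofReal (by simp)]
  refine integrable_congr (Eventually.of_forall fun x => ?_)
  simp [ENNReal.toReal_ofReal (p.2.1 x), mul_comm]

theorem allMoments_noiseLaw : AllMoments (fun x => x) (noiseLaw p.1) := fun q => by
  have h := (p.2.2.2.2.2 (q + 1) (by omega)).1
  rw [← integrable_noiseLaw_iff p (fun x => |x| ^ (2 * (q + 1)))] at h
  have h2 : MemLp (fun x : ℝ => x) ((2 * (q + 1) : ℕ) : ℝ≥0∞) (noiseLaw p.1) := by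
    rw [← integrable_norm_rpow_iff (f := fun x : ℝ => x)
      measurable_id.aestronglyMeasurable (by simp) (ENNReal.natCast_ne_top _)]
    simpa only [ENNReal.toReal_natCast, Real.rpow_natCast, Real.norm_eq_abs] using h
  exact h2.mono_exponent (by exact_mod_cast (by omega : q ≤ 2 * (q + 1)))

theorem integral_noiseLaw_id : ∫ x, x ∂(noiseLaw p.1) = 0 := by
  rw [integral_noiseLaw]; exact p.2.2.2.1

theorem integral_noiseLaw_sq : ∫ x, x ^ 2 ∂(noiseLaw p.1) = 1 := by
  rw [integral_noiseLaw]; exact p.2.2.2.2.1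

theorem integral_noiseLaw_pow_le (hς : 1 ≤ ς) (k : ℕ) :
    ∫ x, x ^ (2 * (k + 1)) ∂(noiseLaw p.1) ≤ ς ^ (k + 1) * ((2 * (k + 1) - 1)‼ : ℕ) := by
  have h := (p.2.2.2.2.2 (k + 1) (by omega)).2
  rw [div_le_one (by positivity)] at h
  rw [integral_noiseLaw]
  simpa only [pow_mul |_|, sq_abs, ← pow_mul] using h

theorem integral_noiseLaw_sq_sub_one : ∫ x, (x ^ 2 - 1) ∂(noiseLaw p.1) = 0 := by
  rw [integral_sub ((allMoments_noiseLaw p).pow 2).integrable (integrable_const _),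
    integral_noiseLaw_sq]
  simp

theorem allMoments_sq_sub_one : AllMoments (fun x => x ^ 2 - 1) (noiseLaw p.1) := by
  simpa only [sub_eq_add_neg] using
    ((allMoments_noiseLaw p).pow 2).add (AllMoments.const (-1))

theorem sq_sub_one_pow_le (x : ℝ) (k : ℕ) :
    (x ^ 2 - 1) ^ (2 * k) ≤ x ^ (2 * (2 * k)) + 1 := by
  have h1 : 0 ≤ x ^ (2 * (2 * k)) := by rw [pow_mul]; positivity
  rw [pow_mul (x ^ 2 - 1)]
  rcases le_total (x ^ 2) 1 with h | h
  · have : ((x ^ 2 - 1) ^ 2) ^ k ≤ 1 := pow_le_one₀ (by positivity) (by nlinarith [sq_nonneg x])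
    linarith
  · have h2 : ((x ^ 2 - 1) ^ 2) ^ k ≤ ((x ^ 2) ^ 2) ^ k := by
      gcongr
      linarith
    rw [← pow_mul (x ^ 2) 2 k, ← pow_mul x 2 (2 * k)] at h2
    linarith

theorem integral_sq_sub_one_pow_le (hς : 1 ≤ ς) (k : ℕ) :
    ∫ x, (x ^ 2 - 1) ^ (2 * (k + 1)) ∂(noiseLaw p.1) ≤
      ς ^ (2 * (k + 1)) * (((2 * (2 * (k + 1)) - 1)‼ : ℕ) + 1) := by
  have h1 : ∫ x, (x ^ 2 - 1) ^ (2 * (k + 1)) ∂(noiseLaw p.1) ≤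
      ∫ x, (x ^ (2 * (2 * (k + 1))) + 1) ∂(noiseLaw p.1) :=
    integral_mono ((allMoments_sq_sub_one p).pow _).integrable
      (((allMoments_noiseLaw p).pow _).integrable.add (integrable_const _))
      fun x => sq_sub_one_pow_le x (k + 1)
  rw [integral_add ((allMoments_noiseLaw p).pow _).integrable (integrable_const _)] at h1
  have h2 := integral_noiseLaw_pow_le p hς (2 * k + 1)
  rw [show 2 * k + 1 + 1 = 2 * (k + 1) by ring] at h2
  have h3 : (1 : ℝ) ≤ ς ^ (2 * (k + 1)) := one_le_pow₀ hς
  simp at h1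
  linarith

end Noise

/-! ### Uniform moments of the path -/

section Path

variable {ς : ℝ} (p : densityClass ς) (a b y₀ : ℝ) (n : ℕ) (S : ℝ → ℝ)

theorem allMoments_path (k : ℕ) : AllMoments (fun ω => path a b y₀ n S ω k)
    (Measure.infinitePi fun _ : ℕ => noiseLaw p.1) := by
  induction k with
  | zero => exact AllMoments.const y₀
  | succ k ih =>
    exact ((AllMoments.const _).mul ih).add (allMoments_coord _ (allMoments_noiseLaw p) _)

/-- Convexity of the even power, since `|s y + x|` is at most the convex combination of `|y|` and
`|x|/ε` with weights `1 - ε` and `ε`. -/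
theorem add_pow_even_le {ε s : ℝ} (hε0 : 0 < ε) (hε1 : ε < 1) (hs : |s| ≤ 1 - ε) (y x : ℝ)
    (k : ℕ) : (s * y + x) ^ (2 * k) ≤
      (1 - ε) * y ^ (2 * k) + ε * (x ^ (2 * k) / ε ^ (2 * k)) := by
  have h1 : |s * y + x| ≤ (1 - ε) * |y| + ε * (|x| / ε) := by
    rw [mul_div_cancel₀ _ hε0.ne']
    refine (abs_add_le _ _).trans ?_
    rw [abs_mul]
    gcongr
  have h2 := (convexOn_pow (𝕜 := ℝ) (2 * k)).2 (mem_Ici.2 (abs_nonneg y))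
    (mem_Ici.2 (by positivity : 0 ≤ |x| / ε)) (by linarith : 0 ≤ 1 - ε) hε0.le (by ring)
  simp only [smul_eq_mul] at h2
  have h3 := pow_le_pow_left₀ (abs_nonneg _) h1 (2 * k)
  have e : ∀ z : ℝ, |z| ^ (2 * k) = z ^ (2 * k) := fun z => by rw [pow_mul, pow_mul, sq_abs]
  rw [div_pow, e, e] at h2
  rw [e] at h3
  exact h3.trans h2

theorem integral_path_pow_le {ε : ℝ} (hε0 : 0 < ε) (hε1 : ε < 1)
    (hS : ∀ j, 1 ≤ j → j ≤ n → |S (xPt a b n j)| ≤ 1 - ε) (hς : 1 ≤ ς) (k j : ℕ) (hj : j ≤ n) :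
    ∫ ω, path a b y₀ n S ω j ^ (2 * (k + 1)) ∂(Measure.infinitePi fun _ : ℕ => noiseLaw p.1) ≤
      ς ^ (k + 1) * (y₀ ^ (2 * (k + 1)) +
        ((2 * (k + 1) - 1)‼ : ℕ) / ε ^ (2 * (k + 1))) := by
  have hς1 : 1 ≤ ς ^ (k + 1) := one_le_pow₀ hς
  have hy : 0 ≤ y₀ ^ (2 * (k + 1)) := by rw [pow_mul]; positivity
  set E : ℝ := ς ^ (k + 1) * ((2 * (k + 1) - 1)‼ : ℕ) with hE
  -- The term `E / ε^(2(k+1))` is the fixed point of the one-step recursion given by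
  -- `add_pow_even_le`, so this bound propagates in `j`.
  suffices h : ∫ ω, path a b y₀ n S ω j ^ (2 * (k + 1))
      ∂(Measure.infinitePi fun _ : ℕ => noiseLaw p.1) ≤
        y₀ ^ (2 * (k + 1)) + E / ε ^ (2 * (k + 1)) by
    refine h.trans ?_
    have h1 : ς ^ (k + 1) * (y₀ ^ (2 * (k + 1)) +
        ((2 * (k + 1) - 1)‼ : ℕ) / ε ^ (2 * (k + 1))) =
        ς ^ (k + 1) * y₀ ^ (2 * (k + 1)) + E / ε ^ (2 * (k + 1)) := by rw [hE]; ring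
    linarith [le_mul_of_one_le_left hy hς1]
  induction j with
  | zero =>
    simp only [path, integral_const, probReal_univ, one_smul]
    have : 0 ≤ E / ε ^ (2 * (k + 1)) := by positivity
    linarith
  | succ j ih =>
    have i1 : Integrable (fun ω => (1 - ε) * path a b y₀ n S ω j ^ (2 * (k + 1)))
        (Measure.infinitePi fun _ : ℕ => noiseLaw p.1) :=
      ((allMoments_path p a b y₀ n S j).pow _).integrable.const_mul _
    have i2 : Integrable (fun ω : ℕ → ℝ => ε * (ω (j + 1) ^ (2 * (k + 1)) / ε ^ (2 * (k + 1))))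
        (Measure.infinitePi fun _ : ℕ => noiseLaw p.1) :=
      (((allMoments_coord _ (allMoments_noiseLaw p) (j + 1)).pow _).integrable.div_const
        _).const_mul _
    have h1 := integral_mono ((allMoments_path p a b y₀ n S (j + 1)).pow (2 * (k + 1))).integrable
      (i1.add i2) (fun ω => add_pow_even_le hε0 hε1 (hS (j + 1) (by omega) hj)
        (path a b y₀ n S ω j) (ω (j + 1)) (k + 1))
    simp only [Pi.add_apply] at h1
    rw [integral_add i1 i2, integral_const_mul, integral_const_mul, integral_div,
      integral_coord _ (g := fun x => x ^ (2 * (k + 1))) (by fun_prop)] at h1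
    have h2 := integral_noiseLaw_pow_le p hς k
    have h3 := mul_le_mul_of_nonneg_left (ih (by omega)) (by linarith : 0 ≤ 1 - ε)
    have h4 : ε * ((∫ x, x ^ (2 * (k + 1)) ∂(noiseLaw p.1)) / ε ^ (2 * (k + 1))) ≤
        ε * (E / ε ^ (2 * (k + 1))) := by gcongr
    refine h1.trans ((add_le_add h3 h4).trans ?_)
    nlinarith

end Path

/-! ### Polynomial tail bounds for the fluctuation terms -/

theorem sum_Ioc_eq_sum_range (f : ℕ → ℝ) (s t : ℕ) :
    ∑ j ∈ Finset.Ioc s t, f j = ∑ i ∈ Finset.range (t - s), f (s + i + 1) := by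
  rw [← Finset.Ico_add_one_add_one_eq_Ioc, Finset.sum_Ico_eq_sum_range, Nat.add_sub_add_right]
  exact Finset.sum_congr rfl fun i _ => by rw [add_right_comm]

/-- Puts the Markov quotient into the form shared by all tail bounds. The `3r` leaves room for sums
slightly longer than the scale `r` of the deviation. -/
theorem tail_ratio_eq (A ς τ : ℝ) {r : ℕ} (hr : 1 ≤ r) (hτ : 0 < τ) (K : ℕ) :
    A * ((3 * r : ℕ) : ℝ) ^ K * ς ^ (2 * K) / (τ * r) ^ (2 * K) =
      A * 3 ^ K * (ς ^ 2 / (τ ^ 2 * r)) ^ K := by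
  have hr0 : (0 : ℝ) < r := by exact_mod_cast hr
  rw [pow_mul, pow_mul, div_pow, mul_pow (τ ^ 2), mul_pow τ, mul_pow (τ ^ 2)]
  push_cast
  rw [mul_pow, pow_two (r : ℝ), mul_pow (r : ℝ)]
  field_simp

/-- Polynomial tail bound for weighted sums `∑ c_j y_{j-1} ξ_j` over short windows. -/
theorem exists_tail_cross (y₀ : ℝ) {ε : ℝ} (hε0 : 0 < ε) (hε1 : ε < 1) (k : ℕ) :
    ∃ C : ℝ, 0 ≤ C ∧ ∀ (a b : ℝ) (n : ℕ) {ς : ℝ} (_ : 1 ≤ ς) (p : densityClass ς) (S : ℝ → ℝ)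
      (_ : ∀ j, 1 ≤ j → j ≤ n → |S (xPt a b n j)| ≤ 1 - ε) (τ : ℝ) (_ : 0 < τ) (r : ℕ)
      (_ : 1 ≤ r) (c : ℕ → ℝ) (s t : ℕ) (_ : t ≤ n) (_ : t ≤ s + 3 * r)
      (_ : ∀ j, 1 ≤ j → j ≤ n → |c j| ≤ 1),
      (Measure.infinitePi fun _ : ℕ => noiseLaw p.1) {ω | τ * r <
        |∑ j ∈ Finset.Ioc s t, c j * path a b y₀ n S ω (j - 1) * ω j|} ≤
          ENNReal.ofReal (C * (ς ^ 2 / (τ ^ 2 * r)) ^ (k + 1)) := by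
  obtain ⟨C, hC, h⟩ := exists_integral_predictable_sum_pow_le k
  set u₀ : ℝ := y₀ ^ (2 * (k + 1)) + ((2 * (k + 1) - 1)‼ : ℕ) / ε ^ (2 * (k + 1)) with hu₀
  set g₀ : ℝ := (((2 * (k + 1) - 1)‼ : ℕ) : ℝ) with hg₀
  have hu₀' : 0 ≤ u₀ := by
    have : 0 ≤ y₀ ^ (2 * (k + 1)) := by rw [pow_mul]; positivity
    positivity
  have hg₀' : 0 ≤ g₀ := Nat.cast_nonneg _
  refine ⟨C * (u₀ * g₀) * 3 ^ (k + 1), by positivity, ?_⟩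
  intro a b n ς hς p S hS τ hτ r hr c s t htn hts hc
  have hr0 : (0 : ℝ) < r := by exact_mod_cast hr
  have hς0 : 0 < ς := by linarith
  have hM : ∀ j, AllMoments (fun ω => c (j + 1) * path a b y₀ n S ω j)
      (Measure.infinitePi fun _ : ℕ => noiseLaw p.1) := fun j =>
    (AllMoments.const _).mul (allMoments_path p a b y₀ n S j)
  have hmom := h (noiseLaw p.1) (fun j ω => c (j + 1) * path a b y₀ n S ω j) (fun x => x)
    (ς ^ (k + 1) * u₀) (ς ^ (k + 1) * g₀) s (3 * r) (t - s)
    (fun j => (measurable_path_coordFiltration a b y₀ n S j).const_mul _) hM measurable_id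
    (allMoments_noiseLaw p) (integral_noiseLaw_id p) (by positivity) (by positivity) (by omega)
    (by omega) (fun j hj => by
      refine le_trans ?_ (integral_path_pow_le p a b y₀ n S hε0 hε1 hS hς k (s + j) (by omega))
      refine integral_mono ((hM _).pow _).integrable
        ((allMoments_path p a b y₀ n S _).pow _).integrable fun ω => ?_
      simp only [mul_pow]
      refine mul_le_of_le_one_left (by rw [pow_mul]; positivity) ?_
      rw [pow_mul]
      refine pow_le_one₀ (sq_nonneg _) ?_
      rw [sq_le_one_iff_abs_le_one]
      exact hc _ (by omega) (by omega))
    (integral_noiseLaw_pow_le p hς k)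
  have hmark := measure_lt_abs_le (AllMoments.sum (s := Finset.range (t - s)) fun i =>
    (hM (s + i)).mul (allMoments_coord _ (allMoments_noiseLaw p) (s + i + 1))) (k + 1)
      (mul_pos hτ hr0) hmom
  simp only [sum_Ioc_eq_sum_range, Nat.add_sub_cancel]
  refine hmark.trans (ENNReal.ofReal_le_ofReal (le_of_eq ?_))
  rw [← tail_ratio_eq _ ς τ hr hτ]
  ring

/-- Polynomial tail bound for `∑ (ξ_j² - 1)` over short windows. -/
theorem exists_tail_sq (k : ℕ) :
    ∃ C : ℝ, 0 ≤ C ∧ ∀ {ς : ℝ} (_ : 1 ≤ ς) (p : densityClass ς) (τ : ℝ) (_ : 0 < τ) (r : ℕ)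
      (_ : 1 ≤ r) (s t : ℕ) (_ : t ≤ s + 3 * r),
      (Measure.infinitePi fun _ : ℕ => noiseLaw p.1) {ω | τ * r <
        |∑ j ∈ Finset.Ioc s t, (ω j ^ 2 - 1)|} ≤
          ENNReal.ofReal (C * (ς ^ 2 / (τ ^ 2 * r)) ^ (k + 1)) := by
  obtain ⟨C, hC, h⟩ := exists_integral_predictable_sum_pow_le k
  set g₀ : ℝ := ((2 * (2 * (k + 1)) - 1)‼ : ℕ) + 1 with hg₀
  have hg₀' : 0 ≤ g₀ := by positivity
  refine ⟨C * g₀ * 3 ^ (k + 1), by positivity, ?_⟩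
  intro ς hς p τ hτ r hr s t hts
  have hr0 : (0 : ℝ) < r := by exact_mod_cast hr
  have hς0 : 0 < ς := by linarith
  -- A constant predictable factor reduces the martingale bound to an i.i.d. sum.
  have hmom := h (noiseLaw p.1) (fun _ _ => 1) (fun x => x ^ 2 - 1)
    1 (ς ^ (2 * (k + 1)) * g₀) s (3 * r) (t - s)
    (fun j => measurable_const) (fun _ => AllMoments.const 1) (by fun_prop)
    (allMoments_sq_sub_one p) (integral_noiseLaw_sq_sub_one p) zero_le_one (by positivity)
    (by omega) (by omega) (fun j hj => by simp) (integral_sq_sub_one_pow_le p hς k)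
  have hmark := measure_lt_abs_le (AllMoments.sum (s := Finset.range (t - s)) fun i =>
    (AllMoments.const 1).mul (allMoments_coord _ (allMoments_sq_sub_one p) (s + i + 1))) (k + 1)
      (mul_pos hτ hr0) hmom
  simp only [sum_Ioc_eq_sum_range]
  simp only [one_mul] at hmark
  refine hmark.trans (ENNReal.ofReal_le_ofReal (le_of_eq ?_))
  rw [← tail_ratio_eq _ ς τ hr hτ]
  ring

/-- Polynomial tail bound for a single squared observation. -/
theorem exists_tail_path (y₀ : ℝ) {ε : ℝ} (hε0 : 0 < ε) (hε1 : ε < 1) (k : ℕ) :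
    ∃ C : ℝ, 0 ≤ C ∧ ∀ (a b : ℝ) (n : ℕ) {ς : ℝ} (_ : 1 ≤ ς) (p : densityClass ς) (S : ℝ → ℝ)
      (_ : ∀ j, 1 ≤ j → j ≤ n → |S (xPt a b n j)| ≤ 1 - ε) (τ : ℝ) (_ : 0 < τ) (_ : τ ≤ 1)
      (r : ℕ) (_ : 1 ≤ r) (t : ℕ) (_ : t ≤ n),
      (Measure.infinitePi fun _ : ℕ => noiseLaw p.1) {ω | τ * r < path a b y₀ n S ω t ^ 2} ≤
          ENNReal.ofReal (C * (ς ^ 2 / (τ ^ 2 * r)) ^ (k + 1)) := by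
  set u₀ : ℝ := y₀ ^ (2 * (k + 1)) + ((2 * (k + 1) - 1)‼ : ℕ) / ε ^ (2 * (k + 1)) with hu₀
  have hu₀' : 0 ≤ u₀ := by
    have : 0 ≤ y₀ ^ (2 * (k + 1)) := by rw [pow_mul]; positivity
    positivity
  refine ⟨u₀, hu₀', ?_⟩
  intro a b n ς hς p S hS τ hτ hτ1 r hr t htn
  have hr0 : (0 : ℝ) < r := by exact_mod_cast hr
  have hτr : 0 < τ * r := mul_pos hτ hr0
  have hmark := measure_lt_abs_le (allMoments_path p a b y₀ n S t) (k + 1)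
      (Real.sqrt_pos.2 hτr) (integral_path_pow_le p a b y₀ n S hε0 hε1 hS hς k t htn)
  have hset : {ω | τ * r < path a b y₀ n S ω t ^ 2} =
      {ω | Real.sqrt (τ * r) < |path a b y₀ n S ω t|} := by
    ext ω
    simp only [mem_ofPred_eq]
    rw [← Real.sqrt_sq_eq_abs, Real.sqrt_lt_sqrt_iff hτr.le]
  rw [hset]
  refine hmark.trans (ENNReal.ofReal_le_ofReal ?_)
  rw [pow_mul √(τ * r), Real.sq_sqrt hτr.le, mul_comm (ς ^ (k + 1)), mul_div_assoc, ← div_pow]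
  -- The natural ratio here is smaller; `1 ≤ ς` and `τ ≤ 1` weaken it to the common one.
  have h1 : ς / (τ * r) ≤ ς ^ 2 / (τ ^ 2 * r) := by
    have h2 : ς ≤ ς ^ 2 := by nlinarith
    have h3 : τ ^ 2 ≤ τ := by nlinarith
    gcongr
  have h4 : 0 ≤ ς / (τ * r) := div_nonneg (by linarith) hτr.le
  gcongr

/-! ### Deterministic energy and estimator bounds -/

theorem sum_Ioc_sub_pred (f : ℕ → ℝ) {s t : ℕ} (hst : s ≤ t) :
    ∑ j ∈ Finset.Ioc s t, (f j - f (j - 1)) = f t - f s := by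
  rw [sum_Ioc_eq_sum_range]
  simp only [Nat.add_sub_cancel]
  simp only [add_assoc]
  rw [Finset.sum_range_sub fun i => f (s + i), Nat.add_sub_cancel' hst, add_zero]

/-- Sum the squared recursion, telescope `y_j² - y_{j-1}²`, and split `ξ_j²` into its mean `1` and a
centred part; the means add up to the window length. -/
theorem sum_sq_pred_identity {y ξ σ : ℕ → ℝ} (hy : ∀ j, 1 ≤ j → y j = σ j * y (j - 1) + ξ j)
    {s t : ℕ} (hst : s ≤ t) :
    ∑ j ∈ Finset.Ioc s t, y (j - 1) ^ 2 + y t ^ 2 - y s ^ 2 =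
      ∑ j ∈ Finset.Ioc s t, σ j ^ 2 * y (j - 1) ^ 2 +
        2 * ∑ j ∈ Finset.Ioc s t, σ j * y (j - 1) * ξ j +
        ∑ j ∈ Finset.Ioc s t, (ξ j ^ 2 - 1) + (t - s : ℕ) := by
  have h1 := sum_Ioc_sub_pred (fun j => y j ^ 2) hst
  have h2 : ∑ j ∈ Finset.Ioc s t, (y j ^ 2 - y (j - 1) ^ 2) =
      ∑ j ∈ Finset.Ioc s t, (σ j ^ 2 * y (j - 1) ^ 2 + 2 * (σ j * y (j - 1) * ξ j) +
        (ξ j ^ 2 - 1) + 1 - y (j - 1) ^ 2) := by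
    refine Finset.sum_congr rfl fun j hj => ?_
    rw [hy j (by have := Finset.mem_Ioc.1 hj; omega)]
    ring
  rw [h1, Finset.sum_sub_distrib, Finset.sum_add_distrib, Finset.sum_add_distrib,
    Finset.sum_add_distrib, ← Finset.mul_sum, Finset.sum_const, Nat.card_Ioc, nsmul_eq_mul,
    mul_one] at h2
  linarith

/-- Lower bound for the energy over a window on which the fluctuation terms are small. -/
theorem le_energy_window {y ξ σ : ℕ → ℝ} (hy : ∀ j, 1 ≤ j → y j = σ j * y (j - 1) + ξ j)
    {s t : ℕ} (hst : s ≤ t) {κ τ : ℝ} (hσ : ∀ j ∈ Finset.Ioc s t, κ ≤ σ j ^ 2)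
    (h1 : |∑ j ∈ Finset.Ioc s t, σ j * y (j - 1) * ξ j| ≤ τ * (t - s : ℕ))
    (h2 : |∑ j ∈ Finset.Ioc s t, (ξ j ^ 2 - 1)| ≤ τ * (t - s : ℕ))
    (h3 : y t ^ 2 ≤ τ * (t - s : ℕ)) :
    (1 - 4 * τ) * (t - s : ℕ) ≤ (1 - κ) * ∑ j ∈ Finset.Ioc s t, y (j - 1) ^ 2 := by
  have h := sum_sq_pred_identity hy hst
  have h4 : κ * ∑ j ∈ Finset.Ioc s t, y (j - 1) ^ 2 ≤
      ∑ j ∈ Finset.Ioc s t, σ j ^ 2 * y (j - 1) ^ 2 := by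
    rw [Finset.mul_sum]
    exact Finset.sum_le_sum fun j hj => mul_le_mul_of_nonneg_right (hσ j hj) (sq_nonneg _)
  have h5 := neg_le_of_abs_le h1
  have h6 := neg_le_of_abs_le h2
  have h7 := sq_nonneg (y s)
  linarith

/-- Projecting onto an interval that contains `c` cannot increase the distance to `c`. -/
theorem abs_clamp_sub_le {x c r Δ : ℝ} (h : |x - c| ≤ Δ) (hc : |c| ≤ r) :
    |min (max x (-r)) r - c| ≤ Δ ∧ |min (max x (-r)) r| ≤ r := by
  obtain ⟨h1, h2⟩ := abs_le.1 h
  obtain ⟨h3, h4⟩ := abs_le.1 hc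
  rw [abs_le, abs_le]
  rcases max_cases x (-r) with ⟨e1, h5⟩ | ⟨e1, h5⟩ <;> rw [e1] <;>
    rcases min_cases x r with ⟨e2, h6⟩ | ⟨e2, h6⟩ <;>
    rcases min_cases (-r) r with ⟨e3, h7⟩ | ⟨e3, h7⟩ <;>
    simp only [e2, e3] <;> refine ⟨⟨?_, ?_⟩, ?_, ?_⟩ <;> linarith

/-- The kernel estimator is close to the local value of the autoregression coefficient. -/
theorem abs_estimator_sub_le {y ξ σ w : ℕ → ℝ}
    (hy : ∀ j, 1 ≤ j → y j = σ j * y (j - 1) + ξ j) {K ι : ℕ} (hK : K < ι) {τ δ σ₀ : ℝ}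
    (hτ : τ ≤ 1 / 8) (hw : ∀ j, w j = 0 ∨ w j = 1) (hw1 : ∀ j ∈ Finset.Ioc K ι, w j = 1)
    (hσ : ∀ j, 1 ≤ j → j ≤ ι → w j = 1 → |σ j - σ₀| ≤ δ)
    (h1 : |∑ j ∈ Finset.Ioc K ι, σ j * y (j - 1) * ξ j| ≤ τ * (ι - K : ℕ))
    (h2 : |∑ j ∈ Finset.Ioc K ι, (ξ j ^ 2 - 1)| ≤ τ * (ι - K : ℕ))
    (h3 : y ι ^ 2 ≤ τ * (ι - K : ℕ))
    (h4 : |∑ j ∈ Finset.Ioc 0 ι, w j * y (j - 1) * ξ j| ≤ τ * (ι - K : ℕ)) :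
    |(∑ j ∈ Finset.Ioc 0 ι, w j * y (j - 1) * y j) /
      (∑ j ∈ Finset.Ioc 0 ι, w j * y (j - 1) ^ 2) - σ₀| ≤ δ + 2 * τ := by
  set q : ℝ := ((ι - K : ℕ) : ℝ) with hq
  have hq0 : 0 < q := by rw [hq]; exact_mod_cast (by omega : 0 < ι - K)
  have hw0 : ∀ j, 0 ≤ w j := fun j => by rcases hw j with h | h <;> simp [h]
  have hτ0 : 0 ≤ τ := by
    have h := (abs_nonneg _).trans h2
    exact nonneg_of_mul_nonneg_left h hq0
  set D := ∑ j ∈ Finset.Ioc 0 ι, w j * y (j - 1) ^ 2 with hD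
  have hDq : q / 2 ≤ D := by
    -- The trivial bound `σ_j² ≥ 0` suffices: `τ ≤ 1/8` leaves at least half of the window length.
    have h5 := le_energy_window hy hK.le (κ := 0) (fun j _ => sq_nonneg _) h1 h2 h3
    have h6 : ∑ j ∈ Finset.Ioc K ι, y (j - 1) ^ 2 ≤ D := by
      calc ∑ j ∈ Finset.Ioc K ι, y (j - 1) ^ 2 = ∑ j ∈ Finset.Ioc K ι, w j * y (j - 1) ^ 2 :=
            Finset.sum_congr rfl fun j hj => by rw [hw1 j hj, one_mul]
        _ ≤ D := Finset.sum_le_sum_of_subset_of_nonneg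
            (Finset.Ioc_subset_Ioc (Nat.zero_le _) le_rfl)
            fun j _ _ => mul_nonneg (hw0 j) (sq_nonneg _)
    rw [← hq] at h5
    nlinarith
  have hD0 : 0 < D := by linarith
  have hnum : ∑ j ∈ Finset.Ioc 0 ι, w j * y (j - 1) * y j - σ₀ * D =
      ∑ j ∈ Finset.Ioc 0 ι, (σ j - σ₀) * (w j * y (j - 1) ^ 2) +
        ∑ j ∈ Finset.Ioc 0 ι, w j * y (j - 1) * ξ j := by
    rw [hD, Finset.mul_sum, ← Finset.sum_sub_distrib, ← Finset.sum_add_distrib]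
    refine Finset.sum_congr rfl fun j hj => ?_
    rw [hy j (by have := Finset.mem_Ioc.1 hj; omega)]
    ring
  have hdrift : |∑ j ∈ Finset.Ioc 0 ι, (σ j - σ₀) * (w j * y (j - 1) ^ 2)| ≤ δ * D := by
    rw [hD, Finset.mul_sum]
    refine (Finset.abs_sum_le_sum_abs _ _).trans (Finset.sum_le_sum fun j hj => ?_)
    have hj' := Finset.mem_Ioc.1 hj
    rw [abs_mul, abs_of_nonneg (mul_nonneg (hw0 j) (sq_nonneg _))]
    rcases hw j with h | h
    · simp [h]
    · exact mul_le_mul_of_nonneg_right (hσ j (by omega) hj'.2 h)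
        (mul_nonneg (hw0 j) (sq_nonneg _))
  have h7 : |∑ j ∈ Finset.Ioc 0 ι, w j * y (j - 1) * y j - σ₀ * D| ≤ (δ + 2 * τ) * D := by
    rw [hnum]
    refine (abs_add_le _ _).trans ?_
    nlinarith
  rw [div_sub' hD0.ne', abs_div, abs_of_pos hD0, div_le_iff₀ hD0, mul_comm D σ₀]
  exact h7

/-- On the event that all fluctuation terms are small, the energy exceeds the threshold. -/
theorem threshold_le_energy {y ξ σ w : ℕ → ℝ}
    (hy : ∀ j, 1 ≤ j → y j = σ j * y (j - 1) + ξ j) {K ι m : ℕ} (hK : K < ι) (hm : ι ≤ m)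
    {ε e τ δ σ₀ : ℝ} (hε1 : ε < 1) (he0 : 0 < e) (heε : e ≤ ε)
    (hτ0 : 0 ≤ τ) (hδ0 : 0 ≤ δ) (hsmall : 8 * τ + 4 * δ ≤ e * ε)
    (hw : ∀ j, w j = 0 ∨ w j = 1) (hw1 : ∀ j ∈ Finset.Ioc K m, w j = 1)
    (hσ₀ : |σ₀| ≤ 1 - ε) (hσ1 : ∀ j, 1 ≤ j → j ≤ m → |σ j| ≤ 1)
    (hσ : ∀ j, 1 ≤ j → j ≤ m → w j = 1 → |σ j - σ₀| ≤ δ)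
    (h1 : |∑ j ∈ Finset.Ioc K ι, σ j * y (j - 1) * ξ j| ≤ τ * (ι - K : ℕ))
    (h2 : |∑ j ∈ Finset.Ioc K ι, (ξ j ^ 2 - 1)| ≤ τ * (ι - K : ℕ))
    (h3 : y ι ^ 2 ≤ τ * (ι - K : ℕ))
    (h4 : |∑ j ∈ Finset.Ioc 0 ι, w j * y (j - 1) * ξ j| ≤ τ * (ι - K : ℕ))
    (h5 : |∑ j ∈ Finset.Ioc ι m, σ j * y (j - 1) * ξ j| ≤ τ * (m - ι : ℕ))
    (h6 : |∑ j ∈ Finset.Ioc ι m, (ξ j ^ 2 - 1)| ≤ τ * (m - ι : ℕ))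
    (h7 : y m ^ 2 ≤ τ * (m - ι : ℕ)) :
    (1 - e) / (1 - min (max ((∑ j ∈ Finset.Ioc 0 ι, w j * y (j - 1) * y j) /
      (∑ j ∈ Finset.Ioc 0 ι, w j * y (j - 1) ^ 2)) (-1 + e)) (1 - e) ^ 2) * (m - ι : ℕ) ≤
      ∑ j ∈ Finset.Ioc ι m, w j * y (j - 1) ^ 2 := by
  have heps : e * ε < 1 := by nlinarith
  have hest := abs_estimator_sub_le hy hK (by linarith) hw
    (fun j hj => hw1 j (Finset.Ioc_subset_Ioc le_rfl hm hj))
    (fun j hj1 hj2 => hσ j hj1 (hj2.trans hm)) h1 h2 h3 h4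
  have hproj := abs_clamp_sub_le (r := 1 - e) hest (by linarith)
  rw [show -1 + e = -(1 - e) by ring]
  set P := min (max ((∑ j ∈ Finset.Ioc 0 ι, w j * y (j - 1) * y j) /
      (∑ j ∈ Finset.Ioc 0 ι, w j * y (j - 1) ^ 2)) (-(1 - e))) (1 - e)
  have hsum : ∑ j ∈ Finset.Ioc ι m, w j * y (j - 1) ^ 2 = ∑ j ∈ Finset.Ioc ι m, y (j - 1) ^ 2 :=
    Finset.sum_congr rfl fun j hj => by
      rw [hw1 j (Finset.Ioc_subset_Ioc hK.le le_rfl hj), one_mul]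
  rw [hsum]
  have hσ₀' := abs_le.1 hσ₀
  -- Factor `σ₀² - σ_j²`: the difference is at most `δ` and the sum at most `2`. The same
  -- factorisation gives `hPσ` below.
  have hlow := le_energy_window hy hm (κ := σ₀ ^ 2 - 2 * δ) (fun j hj => by
    have hj' := Finset.mem_Ioc.1 hj
    have a1 := abs_le.1 (hσ j (by omega) hj'.2 (hw1 j (Finset.Ioc_subset_Ioc hK.le le_rfl hj)))
    have a2 := abs_le.1 (hσ1 j (by omega) hj'.2)
    have a3 : |(σ₀ - σ j) * (σ₀ + σ j)| ≤ δ * 2 := by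
      rw [abs_mul]
      refine mul_le_mul (abs_le.2 ⟨by linarith, by linarith⟩)
        (abs_le.2 ⟨by linarith, by linarith⟩) (abs_nonneg _) hδ0
    have a4 := (abs_le.1 a3).2
    linarith) h5 h6 h7
  set A := ∑ j ∈ Finset.Ioc ι m, y (j - 1) ^ 2
  set N : ℝ := ((m - ι : ℕ) : ℝ)
  have hN : 0 ≤ N := Nat.cast_nonneg _
  set g := 1 - σ₀ ^ 2 with hg
  have hgε : ε ≤ g := by nlinarith
  have hg1 : g ≤ 1 := by nlinarith [sq_nonneg σ₀]
  have hP := abs_le.1 hproj.2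
  have hPσ : g - 2 * (δ + 2 * τ) ≤ 1 - P ^ 2 := by
    have a3 : |(P - σ₀) * (P + σ₀)| ≤ (δ + 2 * τ) * 2 := by
      rw [abs_mul]
      refine mul_le_mul hproj.1
        (abs_le.2 ⟨by linarith, by linarith⟩) (abs_nonneg _) (by linarith)
    have a4 := (abs_le.1 a3).2
    linarith
  have hP0 : 0 < 1 - P ^ 2 := by nlinarith
  have hg2 : 0 < g + 2 * δ := by linarith
  -- After expansion the loss is at most `8τ + 4δ` and the gain at least `e * g ≥ e * ε`; this is
  -- the role of `hsmall`.
  have hscal : (1 - e) * (g + 2 * δ) ≤ (1 - 4 * τ) * (1 - P ^ 2) := by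
    have b1 : (1 - 4 * τ) * (g - 2 * (δ + 2 * τ)) ≤ (1 - 4 * τ) * (1 - P ^ 2) :=
      mul_le_mul_of_nonneg_left hPσ (by linarith)
    have b2 : e * ε ≤ e * g := mul_le_mul_of_nonneg_left hgε he0.le
    have b3 : τ * g ≤ τ := mul_le_of_le_one_right hτ0 hg1
    have b4 : 0 ≤ τ * (δ + 2 * τ) := mul_nonneg hτ0 (by linarith)
    have b5 : 0 ≤ e * δ := mul_nonneg he0.le hδ0
    nlinarith
  rw [div_mul_eq_mul_div, div_le_iff₀ hP0]
  have hfin : (1 - e) * N * (g + 2 * δ) ≤ A * (1 - P ^ 2) * (g + 2 * δ) := by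
    have c1 := mul_le_mul_of_nonneg_right hscal hN
    have c2 := mul_le_mul_of_nonneg_right hlow hP0.le
    have e1 : 1 - (σ₀ ^ 2 - 2 * δ) = g + 2 * δ := by rw [hg]; ring
    rw [e1] at c2
    nlinarith
  exact le_of_mul_le_mul_right hfin hg2

/-! ### Geometry of the windows and regularity of `S` -/

theorem weight_eq_ite {a b : ℝ} (hab : a < b) {n : ℕ} (hd : 0 < dim n) (l j : ℕ) :
    weight a b n l j = if |xPt a b n j - zPt a b n l| ≤ bandwidth a b n then 1 else 0 := by
  have hd' : (0 : ℝ) < dim n := by exact_mod_cast hd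
  have hbw : 0 < bandwidth a b n := div_pos (by linarith) (by linarith)
  have h : (xPt a b n j - zPt a b n l) / bandwidth a b n ∈ Icc (-1 : ℝ) 1 ↔
      |xPt a b n j - zPt a b n l| ≤ bandwidth a b n := by
    rw [mem_Icc, ← abs_le, abs_div, abs_of_pos hbw, div_le_one hbw]
  rw [weight, kernel, indicator_apply]
  simp only [h]

theorem abs_xPt_sub_zPt_le_iff {a b : ℝ} (hab : a < b) {n : ℕ} (hn : 0 < n) (l j : ℕ) :
    |xPt a b n j - zPt a b n l| ≤ bandwidth a b n ↔
      |(j : ℝ) - n * zNorm a b n l| ≤ n * hNorm a b n := by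
  have hn' : (0 : ℝ) < n := by exact_mod_cast hn
  have hba : 0 < b - a := by linarith
  have e1 : xPt a b n j - zPt a b n l =
      ((j : ℝ) - n * zNorm a b n l) * ((b - a) / n) := by
    rw [xPt, zNorm]; field_simp; ring
  have e2 : bandwidth a b n = n * hNorm a b n * ((b - a) / n) := by
    rw [hNorm]; field_simp
  have hpos : 0 < (b - a) / n := div_pos hba hn'
  rw [e1, e2, abs_mul, abs_of_pos hpos, mul_le_mul_iff_left₀ hpos]

theorem xPt_mem_Icc {a b : ℝ} (hab : a < b) {n j : ℕ} (hj : 1 ≤ j) (hjn : j ≤ n) :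
    xPt a b n j ∈ Icc a b := by
  have hn : (0 : ℝ) < n := by exact_mod_cast (by omega : 0 < n)
  have hjn' : (j : ℝ) ≤ n := by exact_mod_cast hjn
  have h1 : (j : ℝ) * (b - a) / n ≤ b - a := by
    rw [div_le_iff₀ hn]
    nlinarith
  have h2 : 0 ≤ (j : ℝ) * (b - a) / n := by
    have : 0 ≤ b - a := by linarith
    positivity
  rw [xPt]
  constructor <;> linarith

theorem zPt_mem_Icc {a b : ℝ} (hab : a < b) {n l : ℕ} (hd : 0 < dim n) (hl : l ≤ dim n) :
    zPt a b n l ∈ Icc a b := by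
  have hd' : (0 : ℝ) < dim n := by exact_mod_cast hd
  have hl' : (l : ℝ) ≤ dim n := by exact_mod_cast hl
  have h1 : (l : ℝ) / dim n ≤ 1 := (div_le_one hd').2 hl'
  have h2 : 0 ≤ (l : ℝ) / dim n := by positivity
  rw [zPt]
  constructor <;> nlinarith

theorem abs_sub_le_of_mem_stabilitySet {a b ε L : ℝ} {S : ℝ → ℝ}
    (hS : S ∈ stabilitySet a b ε L) {x z : ℝ} (hx : x ∈ Icc a b) (hz : z ∈ Icc a b) :
    |S x - S z| ≤ L * |x - z| := by
  have h := (convex_Icc a b).norm_image_sub_le_of_norm_derivWithin_le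
    (hS.1.differentiableOn one_ne_zero) (C := L) (fun u hu => hS.2.2 u hu) hz hx
  simpa [Real.norm_eq_abs] using h

/-- The estimation window starts away from time `0` and is long compared with `q`. -/
theorem window_geometry {a b μ₀ : ℝ} (hab : a < b) {n l : ℕ} (hn : 0 < n) (hd : 0 < dim n)
    (hl1 : 1 ≤ l) (hl : l ≤ dim n)
    (hx : 2 * (n * hNorm a b n) ^ μ₀ + 3 ≤ n * hNorm a b n) :
    kOne a b n l + 2 * qLen a b μ₀ n + 1 ≤ kTwo a b n l ∧ kTwo a b n l ≤ n ∧ 2 ≤ kOne a b n l ∧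
      (∀ j ∈ Finset.Ioc (kOne a b n l) (kTwo a b n l - 1), weight a b n l j = 1) ∧
      ∀ j ≤ kOne a b n l - 2, weight a b n l j = 0 := by
  have hba : 0 < b - a := by linarith
  have hn' : (0 : ℝ) < n := by exact_mod_cast hn
  have hd' : (0 : ℝ) < dim n := by exact_mod_cast hd
  have hl1' : (1 : ℝ) ≤ l := by exact_mod_cast hl1
  have hl' : (l : ℝ) ≤ dim n := by exact_mod_cast hl
  set x := n * hNorm a b n with hxdef
  set z := n * zNorm a b n l with hzdef
  have hx_eq : x = n / (2 * dim n) := by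
    rw [hxdef, hNorm, bandwidth]; field_simp
  -- In index units the windows have half-width `x` and centres spaced by `2x`. Hence `1 ≤ l` keeps
  -- the left edge at distance at least `x` from time `0`.
  have hz_eq : z = l * (2 * x) := by
    rw [hzdef, zNorm, zPt, hx_eq]; field_simp; ring
  have hx0 : 0 < x := by rw [hx_eq]; positivity
  have hxz : 2 * x ≤ z := by rw [hz_eq]; nlinarith
  have hzn : z ≤ n := by
    have : (dim n : ℝ) * (2 * x) = n := by rw [hx_eq]; field_simp
    rw [hz_eq, ← this]
    gcongr
  have hx3 : 3 ≤ x := by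
    have : 0 ≤ x ^ μ₀ := by positivity
    linarith
  have hq : (qLen a b μ₀ n : ℝ) ≤ x ^ μ₀ := Nat.floor_le (by positivity)
  have hk1 : (kOne a b n l : ℝ) ≤ z - x + 1 := by
    rw [kOne]; push_cast
    linarith [Nat.floor_le (show 0 ≤ z - x by linarith)]
  have hk1' : z - x < (kOne a b n l : ℝ) := by
    rw [kOne]; push_cast
    exact Nat.lt_floor_add_one _
  -- Only the left half of the window is used, so the bound also covers `l = d`, where the window is
  -- cut off at `n`.
  have hk2 : z - 1 ≤ (kTwo a b n l : ℝ) := by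
    rw [kTwo, Nat.cast_min, le_min_iff]
    have := Nat.lt_floor_add_one (z + x)
    constructor <;> linarith
  have hk2' : (kTwo a b n l : ℝ) ≤ z + x := by
    rw [kTwo, Nat.cast_min]
    exact (min_le_left _ _).trans (Nat.floor_le (by linarith))
  have hk12 : 2 ≤ kOne a b n l := by
    have : (1 : ℝ) < kOne a b n l := by linarith
    exact_mod_cast this
  refine ⟨?_, min_le_right _ _, hk12, fun j hj => ?_, fun j hj => ?_⟩
  · have : (kOne a b n l : ℝ) + 2 * qLen a b μ₀ n + 1 ≤ kTwo a b n l := by linarith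
    exact_mod_cast this
  · rw [weight_eq_ite hab hd, if_pos]
    rw [abs_xPt_sub_zPt_le_iff hab hn, ← hxdef, ← hzdef, abs_le]
    have hj' := Finset.mem_Ioc.1 hj
    have h1 : (kOne a b n l : ℝ) ≤ j := by exact_mod_cast hj'.1.le
    have h2 : (j : ℝ) ≤ kTwo a b n l := by exact_mod_cast hj'.2.trans (Nat.sub_le _ _)
    constructor <;> linarith
  -- The index `k₁ - 1` must be excluded: when `z - x` is an integer it lies exactly on the edge and
  -- has weight `1`.
  · rw [weight_eq_ite hab hd, if_neg]
    rw [abs_xPt_sub_zPt_le_iff hab hn, ← hxdef, ← hzdef, abs_le]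
    have h1 : (j : ℝ) + 2 ≤ kOne a b n l := by exact_mod_cast (by omega : j + 2 ≤ kOne a b n l)
    intro h
    linarith [h.1]

/-! ### Failure probability of one window -/

/-- Needed to evaluate the pushforward `obsLaw` on the complement of the event. -/
theorem measurableSet_gammaEvent (a b μ₀ : ℝ) (n l : ℕ) :
    MeasurableSet (gammaEvent a b μ₀ n l) := by
  have henergy : ∀ k m, Measurable (energy a b n l k m) := fun k m => by
    unfold energy; fun_prop
  have hest : Measurable (prelimEst a b μ₀ n l) := by
    have := henergy 0 (iotaIdx a b μ₀ n l)
    unfold prelimEst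
    fun_prop
  have hproj : Measurable (projEst a b μ₀ n l) :=
    (hest.max measurable_const).min measurable_const
  have hthr : Measurable (threshold a b μ₀ n l) :=
    (measurable_const.div (measurable_const.sub (hproj.pow_const 2))).mul measurable_const
  exact measurableSet_le hthr (henergy _ _)

theorem measure_union_le_ofReal {Ω : Type*} [MeasurableSpace Ω] {μ : Measure Ω} {A B : Set Ω}
    {x y R : ℝ} (hx : 0 ≤ x) (hy : 0 ≤ y) (hR : 0 ≤ R) (hA : μ A ≤ ENNReal.ofReal (x * R))
    (hB : μ B ≤ ENNReal.ofReal (y * R)) : μ (A ∪ B) ≤ ENNReal.ofReal ((x + y) * R) := by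
  rw [add_mul, ENNReal.ofReal_add (by positivity) (by positivity)]
  exact (measure_union_le _ _).trans (add_le_add hA hB)

/-- Polynomial bound for the probability that a single window fails. -/
theorem exists_measure_gammaEvent_compl_le {a b : ℝ} (hab : a < b) {ε L : ℝ} (hε0 : 0 < ε)
    (hε1 : ε < 1) (hL : 0 < L) (μ₀ y₀ : ℝ) (k : ℕ) :
    ∃ C : ℝ, 0 ≤ C ∧ ∀ (n l : ℕ) {ς : ℝ} (_ : 1 ≤ ς) (p : densityClass ς) (S : ℝ → ℝ)
      (_ : S ∈ stabilitySet a b ε L) (_ : 0 < n) (_ : 0 < dim n) (_ : 1 ≤ l) (_ : l ≤ dim n)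
      (_ : 1 ≤ qLen a b μ₀ n) (_ : 2 * (n * hNorm a b n) ^ μ₀ + 3 ≤ n * hNorm a b n)
      (_ : epsTilde n ≤ ε) (_ : 0 < epsTilde n)
      (_ : 8 * (L * bandwidth a b n) ≤ epsTilde n * ε),
      obsLaw a b y₀ n p S (gammaEvent a b μ₀ n l)ᶜ ≤ ENNReal.ofReal
        (C * (ς ^ 2 / ((epsTilde n * ε / 16) ^ 2 * qLen a b μ₀ n)) ^ (k + 1)) := by
  obtain ⟨C₁, hC₁, hcross⟩ := exists_tail_cross y₀ hε0 hε1 k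
  obtain ⟨C₂, hC₂, hsq⟩ := exists_tail_sq k
  obtain ⟨C₃, hC₃, hpath⟩ := exists_tail_path y₀ hε0 hε1 k
  refine ⟨C₁ + (C₂ + (C₃ + (C₁ + (C₁ + (C₂ + C₃))))), by positivity, ?_⟩
  intro n l ς hς p S hS hn hd hl1 hl hq hx heε he0 hLb
  obtain ⟨hk, hkn, hk2, hw1, hw0⟩ := window_geometry hab hn hd hl1 hl hx
  rw [obsLaw, Measure.map_apply (measurable_path a b y₀ n S)
    (measurableSet_gammaEvent a b μ₀ n l).compl]
  set μ := Measure.infinitePi fun _ : ℕ => noiseLaw p.1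
  set τ := epsTilde n * ε / 16 with hτ
  have hτ0 : 0 < τ := by positivity
  have hτ1 : τ ≤ 1 := by nlinarith
  set q := qLen a b μ₀ n with hqdef
  set K := kOne a b n l
  set m := kTwo a b n l - 1 with hm
  have hι : iotaIdx a b μ₀ n l = K + q := rfl
  set N := m - (K + q) with hN
  have hqN : q ≤ N := by omega
  set R := (ς ^ 2 / (τ ^ 2 * q)) ^ (k + 1) with hR
  have hq0 : (0 : ℝ) < q := by exact_mod_cast hq
  have hR0 : 0 ≤ R := by positivity
  -- The second stretch has length `N ≥ q`, so its tail bounds are dominated by those at scale `q`.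
  have hNR : ∀ C : ℝ, 0 ≤ C → ENNReal.ofReal (C * (ς ^ 2 / (τ ^ 2 * N)) ^ (k + 1)) ≤
      ENNReal.ofReal (C * R) := fun C hC => by
    have hqN' : (q : ℝ) ≤ N := by exact_mod_cast hqN
    refine ENNReal.ofReal_le_ofReal ?_
    rw [hR]
    gcongr
  have hSx : ∀ j, 1 ≤ j → j ≤ n → |S (xPt a b n j)| ≤ 1 - ε := fun j h1 h2 =>
    hS.2.1 _ (xPt_mem_Icc hab h1 h2)
  have hSx1 : ∀ j, 1 ≤ j → j ≤ n → |S (xPt a b n j)| ≤ 1 := fun j h1 h2 =>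
    (hSx j h1 h2).trans (by linarith)
  have hw : ∀ j, weight a b n l j = 0 ∨ weight a b n l j = 1 := fun j => by
    rw [weight_eq_ite hab hd]
    split_ifs <;> simp
  have hwabs : ∀ j, |weight a b n l j| ≤ 1 := fun j => by
    rcases hw j with h | h <;> simp [h]
  have hbw : 0 ≤ bandwidth a b n := by
    have : 0 < b - a := by linarith
    rw [bandwidth]; positivity
  let c : ℕ → ℝ := fun j => S (xPt a b n j)
  have b1 := hcross a b n hς p S hSx τ hτ0 q hq c K (K + q) (by omega) (by omega) hSx1
  have b2 := hsq hς p τ hτ0 q hq K (K + q) (by omega)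
  have b3 := hpath a b n hς p S hSx τ hτ0 hτ1 q hq (K + q) (by omega)
  -- The estimator's noise sum effectively starts after `K - 2`, since earlier weights vanish; its
  -- `q + 2` terms fit into `3q` because `1 ≤ q`.
  have b4 := hcross a b n hς p S hSx τ hτ0 q hq (weight a b n l) (K - 2) (K + q) (by omega)
    (by omega) (fun j _ _ => hwabs j)
  have b5 := (hcross a b n hς p S hSx τ hτ0 N (by omega) c (K + q) m (by omega) (by omega)
    hSx1).trans (hNR _ hC₁)
  have b6 := (hsq hς p τ hτ0 N (by omega) (K + q) m (by omega)).trans (hNR _ hC₂)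
  have b7 := (hpath a b n hς p S hSx τ hτ0 hτ1 N (by omega) m (by omega)).trans (hNR _ hC₃)
  have hU := measure_union_le_ofReal hC₁ (by positivity) hR0 b1 <|
    measure_union_le_ofReal hC₂ (by positivity) hR0 b2 <|
    measure_union_le_ofReal hC₃ (by positivity) hR0 b3 <|
    measure_union_le_ofReal hC₁ (by positivity) hR0 b4 <|
    measure_union_le_ofReal hC₁ (by positivity) hR0 b5 <|
    measure_union_le_ofReal hC₂ hC₃ hR0 b6 b7
  refine (measure_mono fun ω hω => ?_).trans hU
  by_contra hgood
  simp only [mem_union, mem_ofPred_eq, not_or, not_lt] at hgood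
  obtain ⟨g1, g2, g3, g4, g5, g6, g7⟩ := hgood
  apply hω
  have hsum : ∑ j ∈ Finset.Ioc 0 (K + q), weight a b n l j * path a b y₀ n S ω (j - 1) * ω j =
      ∑ j ∈ Finset.Ioc (K - 2) (K + q),
        weight a b n l j * path a b y₀ n S ω (j - 1) * ω j := by
    symm
    refine Finset.sum_subset (Finset.Ioc_subset_Ioc (Nat.zero_le _) le_rfl) fun j hj hj' => ?_
    rw [hw0 j ?_, zero_mul, zero_mul]
    simp only [Finset.mem_Ioc] at hj hj'
    omega
  rw [← hsum] at g4
  have eq1 : K + q - K = q := by omega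
  have key := threshold_le_energy (y := path a b y₀ n S ω) (ξ := ω)
    (σ := fun j => S (xPt a b n j)) (w := weight a b n l) (K := K) (ι := K + q) (m := m)
    (ε := ε) (e := epsTilde n) (τ := τ) (δ := L * bandwidth a b n) (σ₀ := S (zPt a b n l))
    (fun j hj => by
      obtain ⟨i, rfl⟩ := Nat.exists_eq_add_of_le' hj
      rfl)
    (by omega) (by omega) hε1 he0 heε hτ0.le (by positivity) (by linarith) hw hw1
    (hS.2.1 _ (zPt_mem_Icc hab hd hl)) (fun j h1 h2 => hSx1 j h1 (by omega))
    (fun j h1 h2 h3 => by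
      refine (abs_sub_le_of_mem_stabilitySet hS (xPt_mem_Icc hab h1 (by omega))
        (zPt_mem_Icc hab hd hl)).trans ?_
      rw [weight_eq_ite hab hd] at h3
      have : |xPt a b n j - zPt a b n l| ≤ bandwidth a b n := by
        by_contra h4
        simp [h4] at h3
      gcongr)
    (by rw [eq1]; exact g1) (by rw [eq1]; exact g2) (by rw [eq1]; exact g3)
    (by rw [eq1]; exact g4) g5 g6 g7
  have hNcast : ((m - (K + q) : ℕ) : ℝ) = (kTwo a b n l : ℝ) - ((K + q : ℕ) : ℝ) - 1 := by
    rw [Nat.cast_sub (by omega), hm, Nat.cast_sub (by omega)]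
    push_cast; ring
  rw [hNcast] at key
  exact key

/-! ### Asymptotics of the tuning parameters -/

theorem tendsto_two_add_log_div_rpow {δ : ℝ} (hδ : 0 < δ) :
    Tendsto (fun n : ℕ => (2 + Real.log n) / (n : ℝ) ^ δ) atTop (𝓝 0) := by
  have h1 : Tendsto (fun x : ℝ => Real.log x / x ^ δ) atTop (𝓝 0) :=
    (isLittleO_log_rpow_atTop hδ).tendsto_div_nhds_zero
  have h2 : Tendsto (fun x : ℝ => 2 / x ^ δ) atTop (𝓝 0) :=
    (tendsto_rpow_atTop hδ).const_div_atTop 2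
  have h3 := (h2.add h1).comp tendsto_natCast_atTop_atTop
  rw [add_zero] at h3
  refine h3.congr fun n => ?_
  simp only [Function.comp_apply, add_div]

theorem tendsto_epsTilde : Tendsto epsTilde atTop (𝓝 0) := by
  have h : Tendsto (fun n : ℕ => 2 + Real.log n) atTop atTop :=
    tendsto_atTop_add_const_left _ _ (Real.tendsto_log_atTop.comp tendsto_natCast_atTop_atTop)
  exact h.const_div_atTop 1

theorem epsTilde_pos {n : ℕ} (hn : 0 < n) : 0 < epsTilde n := by
  have : 0 ≤ Real.log n := Real.log_nonneg (by exact_mod_cast hn)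
  rw [epsTilde]; positivity

theorem dim_pos {n : ℕ} (hn : 0 < n) : 0 < dim n :=
  Nat.floor_pos.2 (Real.one_le_sqrt.2 (by exact_mod_cast hn))

theorem dim_le_sqrt (n : ℕ) : (dim n : ℝ) ≤ √n := Nat.floor_le (Real.sqrt_nonneg _)

theorem sqrt_le_two_mul_dim {n : ℕ} (hn : 0 < n) : √n ≤ 2 * dim n := by
  have h1 : √(n : ℝ) < dim n + 1 := Nat.lt_floor_add_one _
  have h2 : (1 : ℝ) ≤ dim n := by exact_mod_cast dim_pos hn
  linarith

theorem sqrt_div_two_le {a b : ℝ} (hab : a < b) {n : ℕ} (hn : 0 < n) :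
    √n / 2 ≤ n * hNorm a b n := by
  have hba : 0 < b - a := by linarith
  have hd : (0 : ℝ) < dim n := by exact_mod_cast dim_pos hn
  have h : n * hNorm a b n = n / (2 * dim n) := by
    rw [hNorm, bandwidth]; field_simp
  rw [h, le_div_iff₀ (by positivity)]
  have h1 := mul_le_mul_of_nonneg_left (dim_le_sqrt n) (Real.sqrt_nonneg (n : ℝ))
  rw [Real.mul_self_sqrt (Nat.cast_nonneg n)] at h1
  linarith

theorem tendsto_mul_hNorm {a b : ℝ} (hab : a < b) :
    Tendsto (fun n : ℕ => n * hNorm a b n) atTop atTop := by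
  refine tendsto_atTop_mono' _ ?_
    ((Real.tendsto_sqrt_atTop.comp tendsto_natCast_atTop_atTop).atTop_div_const two_pos)
  filter_upwards [eventually_gt_atTop 0] with n hn
  exact sqrt_div_two_le hab hn

theorem eventually_two_mul_rpow_add_three_le {μ₀ : ℝ} (hμ1 : μ₀ < 1) :
    ∀ᶠ x : ℝ in atTop, 2 * x ^ μ₀ + 3 ≤ x := by
  have h1 := (tendsto_rpow_neg_atTop (by linarith : 0 < 1 - μ₀)).eventually_le_const
    (by norm_num : (0 : ℝ) < 1 / 4)
  filter_upwards [h1, eventually_ge_atTop 6] with x hx hx6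
  have h2 : x ^ μ₀ = x ^ (-(1 - μ₀)) * x := by
    rw [← Real.rpow_add_one (by linarith)]
    congr 1; ring
  rw [h2]
  nlinarith

/-- One factor `2` is lost to the integer part and another to `2^μ₀ ≤ 2`, starting from `√n / 2 ≤ n
h̃`. -/
theorem rpow_div_four_le_qLen {a b : ℝ} (hab : a < b) {μ₀ : ℝ} (hμ0 : 0 < μ₀) (hμ1 : μ₀ < 1)
    {n : ℕ} (hn : 0 < n) (hx : 1 ≤ n * hNorm a b n) :
    1 ≤ qLen a b μ₀ n ∧ (n : ℝ) ^ (μ₀ / 2) / 4 ≤ qLen a b μ₀ n := by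
  have hX1 : 1 ≤ (n * hNorm a b n) ^ μ₀ := Real.one_le_rpow hx hμ0.le
  have hq1 : 1 ≤ qLen a b μ₀ n := Nat.floor_pos.2 hX1
  refine ⟨hq1, ?_⟩
  have h1 : (n * hNorm a b n) ^ μ₀ < qLen a b μ₀ n + 1 := Nat.lt_floor_add_one _
  have h2 : (1 : ℝ) ≤ qLen a b μ₀ n := by exact_mod_cast hq1
  have h3 : (√n / 2) ^ μ₀ ≤ (n * hNorm a b n) ^ μ₀ :=
    Real.rpow_le_rpow (by positivity) (sqrt_div_two_le hab hn) hμ0.le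
  have h4 : (n : ℝ) ^ (μ₀ / 2) / 2 ≤ (√n / 2) ^ μ₀ := by
    rw [Real.div_rpow (Real.sqrt_nonneg _) two_pos.le, Real.sqrt_eq_rpow,
      ← Real.rpow_mul (Nat.cast_nonneg _), show 1 / 2 * μ₀ = μ₀ / 2 by ring]
    have h5 : (2 : ℝ) ^ μ₀ ≤ 2 := by
      simpa using Real.rpow_le_rpow_of_exponent_le one_le_two hμ1.le
    gcongr
  linarith

/-- The basic tail ratio decays polynomially in `n`. -/
theorem eventually_ratio_le {a b : ℝ} (hab : a < b) {ε μ₀ : ℝ} (hε0 : 0 < ε) (hμ0 : 0 < μ₀)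
    (hμ1 : μ₀ < 1) {ς : ℕ → ℝ}
    (hς : ∀ δ : ℝ, 0 < δ → Tendsto (fun n : ℕ => ς n / (n : ℝ) ^ δ) atTop (𝓝 0)) :
    ∀ᶠ n : ℕ in atTop, ς n ^ 2 / ((epsTilde n * ε / 16) ^ 2 * qLen a b μ₀ n) ≤
      (n : ℝ) ^ (-(μ₀ / 4)) := by
  -- With `P = n^(μ₀/16)`, the length `q` supplies `P^8`. The squares of `ς` and of `2 + ln n` each
  -- use up `P^2`, leaving `P^(-4) = n^(-μ₀/4)`.
  have hδ : 0 < μ₀ / 16 := by positivity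
  have h1 := (((hς _ hδ).pow 2).mul ((tendsto_two_add_log_div_rpow hδ).pow 2)).const_mul
    (1024 / ε ^ 2)
  simp only [ne_eq, OfNat.ofNat_ne_zero, not_false_eq_true, zero_pow, mul_zero] at h1
  filter_upwards [h1.eventually_le_const one_pos, eventually_gt_atTop 0,
    (tendsto_mul_hNorm hab).eventually_ge_atTop 1] with n hn1 hn hx
  have hn' : (0 : ℝ) < n := by exact_mod_cast hn
  obtain ⟨hq1, hq⟩ := rpow_div_four_le_qLen hab hμ0 hμ1 hn hx
  have hlog : 0 ≤ Real.log n := Real.log_nonneg (by exact_mod_cast hn)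
  have he := epsTilde_pos hn
  have hP : 0 < (n : ℝ) ^ (μ₀ / 16) := Real.rpow_pos_of_pos hn' _
  set P := (n : ℝ) ^ (μ₀ / 16) with hPdef
  have e8 : (n : ℝ) ^ (μ₀ / 2) = P ^ 8 := by
    rw [hPdef, ← Real.rpow_natCast, ← Real.rpow_mul hn'.le]; congr 1; push_cast; ring
  have e4 : (n : ℝ) ^ (-(μ₀ / 4)) = (P ^ 4)⁻¹ := by
    rw [Real.rpow_neg hn'.le, hPdef, ← Real.rpow_natCast, ← Real.rpow_mul hn'.le]
    congr 2; push_cast; ring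
  rw [e8] at hq
  rw [e4]
  calc ς n ^ 2 / ((epsTilde n * ε / 16) ^ 2 * qLen a b μ₀ n)
      ≤ ς n ^ 2 / ((epsTilde n * ε / 16) ^ 2 * (P ^ 8 / 4)) := by gcongr
    _ = 1024 / ε ^ 2 * ((ς n / P) ^ 2 * ((2 + Real.log n) / P) ^ 2) * (P ^ 4)⁻¹ := by
        rw [epsTilde]
        have : 2 + Real.log n ≠ 0 := by positivity
        field_simp
        ring
    _ ≤ 1 * (P ^ 4)⁻¹ := by gcongr
    _ = (P ^ 4)⁻¹ := one_mul _

theorem eventually_bandwidth_le {a b : ℝ} (hab : a < b) {ε L : ℝ} (hε0 : 0 < ε) (hL : 0 < L) :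
    ∀ᶠ n : ℕ in atTop, 8 * (L * bandwidth a b n) ≤ epsTilde n * ε := by
  have hba : 0 < b - a := by linarith
  have h1 := (tendsto_two_add_log_div_rpow (by norm_num : (0 : ℝ) < 1 / 2)).const_mul
    (8 * L * (b - a))
  rw [mul_zero] at h1
  filter_upwards [h1.eventually_le_const hε0, eventually_gt_atTop 0] with n hn1 hn
  have hn' : (0 : ℝ) < n := by exact_mod_cast hn
  have hlog : 0 ≤ Real.log n := Real.log_nonneg (by exact_mod_cast hn)
  have hs : 0 < √(n : ℝ) := Real.sqrt_pos.2 hn'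
  rw [← Real.sqrt_eq_rpow] at hn1
  have h2 : bandwidth a b n ≤ (b - a) / √n := by
    rw [bandwidth]
    have := sqrt_le_two_mul_dim hn
    gcongr
  rw [epsTilde, one_div_mul_eq_div, le_div_iff₀ (by positivity)]
  calc 8 * (L * bandwidth a b n) * (2 + Real.log n)
      ≤ 8 * (L * ((b - a) / √n)) * (2 + Real.log n) := by gcongr
    _ = 8 * L * (b - a) * ((2 + Real.log n) / √n) := by ring
    _ ≤ ε := hn1

/-! ### Union over the windows and conclusion -/

theorem measure_gammaAll_compl_le (a b μ₀ : ℝ) (n : ℕ) (P : Measure (ℕ → ℝ)) {B : ℝ≥0∞}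
    (h : ∀ l, 1 ≤ l → l ≤ dim n → P (gammaEvent a b μ₀ n l)ᶜ ≤ B) :
    P (gammaAll a b μ₀ n)ᶜ ≤ dim n * B := by
  rw [gammaAll, compl_iInter₂]
  refine (measure_biUnion_finset_le _ _).trans ?_
  refine (Finset.sum_le_card_nsmul _ _ B fun l hl => ?_).trans ?_
  · exact h l (Finset.mem_Icc.1 hl).1 (Finset.mem_Icc.1 hl).2
  · simp

end SeqAR

theorem mainTheorem5 (a b : ℝ) (hab : a < b) (ε L : ℝ) (hε0 : 0 < ε) (hε1 : ε < 1)
    (hL : 0 < L) (μ₀ : ℝ) (hμ0 : 0 < μ₀) (hμ1 : μ₀ < 1) (y₀ : ℝ)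
    (ς : ℕ → ℝ) (hς1 : ∀ n, 1 ≤ ς n)
    (hς : ∀ δ : ℝ, 0 < δ → Tendsto (fun n : ℕ => ς n / (n : ℝ) ^ δ) atTop (𝓝 0))
    (p : ∀ n : ℕ, SeqAR.densityClass (ς n)) (β : ℝ) (hβ : 0 < β) :
    Tendsto (fun n : ℕ => (n : ℝ≥0∞) ^ β *
        ⨆ S ∈ SeqAR.stabilitySet a b ε L,
          SeqAR.obsLaw a b y₀ n (p n) S (SeqAR.gammaAll a b μ₀ n)ᶜ)
      atTop (𝓝 0) := by
  -- The moment order makes the window bound `O(n^(-(β+2)))`: `β` for the prefactor, one power for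
  -- the `d ≤ n` windows, and one left over for convergence.
  set k : ℕ := ⌈(β + 2) * (4 / μ₀)⌉₊ with hk
  have hkβ : β + 2 ≤ μ₀ / 4 * (k + 1) := by
    have h1 : (β + 2) * (4 / μ₀) ≤ k := Nat.le_ceil _
    have h2 : β + 2 = μ₀ / 4 * ((β + 2) * (4 / μ₀)) := by field_simp
    rw [h2]
    gcongr
    linarith
  obtain ⟨C, hC, hbound⟩ :=
    SeqAR.exists_measure_gammaEvent_compl_le hab hε0 hε1 hL μ₀ y₀ k
  have hlim : Tendsto (fun n : ℕ => ENNReal.ofReal (C / n)) atTop (𝓝 0) := by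
    have h := ENNReal.tendsto_ofReal
      ((tendsto_natCast_atTop_atTop (R := ℝ)).const_div_atTop C)
    rwa [ENNReal.ofReal_zero] at h
  refine tendsto_of_tendsto_of_tendsto_of_le_of_le' tendsto_const_nhds hlim
    (Eventually.of_forall fun _ => zero_le) ?_
  filter_upwards [eventually_gt_atTop 0, SeqAR.eventually_ratio_le hab hε0 hμ0 hμ1 hς,
    SeqAR.eventually_bandwidth_le hab hε0 hL,
    (SeqAR.tendsto_mul_hNorm hab).eventually (SeqAR.eventually_two_mul_rpow_add_three_le hμ1),
    (SeqAR.tendsto_mul_hNorm hab).eventually_ge_atTop 1,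
    SeqAR.tendsto_epsTilde.eventually_le_const hε0] with n hn hratio hbw hx hx1 he
  have hn' : (0 : ℝ) < n := by exact_mod_cast hn
  have hn1 : (1 : ℝ) ≤ n := by exact_mod_cast hn
  have hdn : (SeqAR.dim n : ℝ) ≤ n := (SeqAR.dim_le_sqrt n).trans
    (Real.sqrt_le_iff.2 ⟨hn'.le, by nlinarith⟩)
  have hq := (SeqAR.rpow_div_four_le_qLen hab hμ0 hμ1 hn hx1).1
  have he0 := SeqAR.epsTilde_pos hn
  set ρ := ς n ^ 2 / ((SeqAR.epsTilde n * ε / 16) ^ 2 * SeqAR.qLen a b μ₀ n) with hρ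
  have hρ0 : 0 ≤ ρ := by positivity
  have hsup : ⨆ S ∈ SeqAR.stabilitySet a b ε L,
      SeqAR.obsLaw a b y₀ n (p n) S (SeqAR.gammaAll a b μ₀ n)ᶜ ≤
        SeqAR.dim n * ENNReal.ofReal (C * ρ ^ (k + 1)) :=
    iSup₂_le fun S hS => SeqAR.measure_gammaAll_compl_le a b μ₀ n _ fun l hl1 hl =>
      hbound n l (hς1 n) (p n) S hS hn (SeqAR.dim_pos hn) hl1 hl hq hx he he0 hbw
  refine (mul_le_mul_right hsup _).trans ?_
  rw [← ENNReal.ofReal_natCast n, ← ENNReal.ofReal_natCast (SeqAR.dim n),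
    ENNReal.ofReal_rpow_of_pos hn', ← ENNReal.ofReal_mul (Nat.cast_nonneg _),
    ← ENNReal.ofReal_mul (by positivity)]
  refine ENNReal.ofReal_le_ofReal ?_
  have hpow : ρ ^ (k + 1) ≤ (n : ℝ) ^ (-(β + 2)) := by
    calc ρ ^ (k + 1) ≤ ((n : ℝ) ^ (-(μ₀ / 4))) ^ (k + 1) := by gcongr
      _ = (n : ℝ) ^ (-(μ₀ / 4 * (k + 1))) := by
          rw [← Real.rpow_natCast, ← Real.rpow_mul hn'.le]
          push_cast
          congr 1; ring
      _ ≤ (n : ℝ) ^ (-(β + 2)) := Real.rpow_le_rpow_of_exponent_le hn1 (by linarith)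
  calc (n : ℝ) ^ β * (SeqAR.dim n * (C * ρ ^ (k + 1)))
      ≤ (n : ℝ) ^ β * (n * (C * (n : ℝ) ^ (-(β + 2)))) := by gcongr
    _ = C * ((n : ℝ) ^ β * (n : ℝ) ^ (1 : ℝ) * (n : ℝ) ^ (-(β + 2))) := by
        rw [Real.rpow_one]; ring
    _ = C * (n : ℝ) ^ (-1 : ℝ) := by
        rw [← Real.rpow_add hn', ← Real.rpow_add hn']
        congr 2; ring
    _ = C / n := by rw [Real.rpow_neg_one, div_eq_mul_inv]
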